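/- Let $S$ and $T$ be tangles with four ends NW, NE, SW, SE (no orientation of the ends is prescribed). Let $S+T$ be their sum, obtained by placing $T$ to the right of $S$ and joining the ends NE and SE of $S$ to the ends NW and SW of $T$, respectively. For a tangle $X$, let $N(X)$ be its numerator closure, obtained by joining NW to NE and SW to SE by simple arcs. Suppose that $N(T)$ and $N(S+T)$ are knots in $S^3$ and that $N(S)$ is a split link. Let $\Delta_K(t)\in\mathbb{Z}[t,t^{-1}]$ denote the Alexander polynomial of a knot $K$, which is defined up to multiplication by units $\pm t^k$. Then every root $t\in\mathbb{C}\setminus\{0\}$ of $\Delta_{N(T)}(t)$ is also a root of $\Delta_{N(S+T)}(t)$. -/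

import Mathlib

open scoped LaurentPolynomial

/-! ### Greatest common divisors -/

/-- Every set of Laurent polynomials has a greatest common divisor; so the one used below to define
the Alexander polynomial exists. -/
theorem LaurentPolynomial.exists_gcd (s : Set ℤ[T;T⁻¹]) :
    ∃ Δ : ℤ[T;T⁻¹], ∀ d : ℤ[T;T⁻¹], d ∣ Δ ↔ ∀ μ ∈ s, d ∣ μ := by
  have : UniqueFactorizationMonoid ℤ[T;T⁻¹] :=
    UniqueFactorizationMonoid.of_isLocalization (Submonoid.powers (Polynomial.X : Polynomial ℤ)) _
  have : IsNoetherianRing ℤ[T;T⁻¹] :=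
    IsLocalization.isNoetherianRing (Submonoid.powers (Polynomial.X : Polynomial ℤ)) _ inferInstance
  let _ : StrongNormalizationMonoid ℤ[T;T⁻¹] :=
    UniqueFactorizationMonoid.strongNormalizationMonoid
  let _ := UniqueFactorizationMonoid.toNormalizedGCDMonoid ℤ[T;T⁻¹]
  obtain ⟨F, hF⟩ := IsNoetherian.noetherian (Ideal.span s)
  refine ⟨F.gcd id, fun d => ?_⟩
  have key : ∀ u : Set ℤ[T;T⁻¹], (∀ μ ∈ u, d ∣ μ) ↔ Ideal.span u ≤ Ideal.span {d} := by
    intro u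
    rw [Ideal.span_le]
    exact forall₂_congr fun μ _ => Ideal.mem_span_singleton.symm
  have h2 := key (F : Set ℤ[T;T⁻¹])
  rw [Finset.dvd_gcd_iff, key s, ← hF]
  exact h2

/-! ### Tangle diagrams

A tangle diagram in general position with respect to a height function is cut by horizontal lines
into slices, read from bottom to top, each of which contains a single minimum, maximum or crossing;
all the other strands run vertically. -/

/-- What happens in a slice: a local minimum, a local maximum, or a crossing.  In `cross true` the
strand which runs from the bottom left to the top right is the over-strand, in `cross false` it is
the under-strand. -/
inductive SliceKind : Type
  | cup : SliceKind
  | cap : SliceKind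
  | cross : Bool → SliceKind

namespace SliceKind

/-- The number of end points at the bottom. -/
def ins : SliceKind → ℕ
  | cup => 0
  | cap => 2
  | cross _ => 2

/-- The number of end points at the top. -/
def outs : SliceKind → ℕ
  | cup => 2
  | cap => 0
  | cross _ => 2

end SliceKind

/-- A slice: its minimum, maximum or crossing has exactly `pos` vertical strands on its left. -/
structure Slice : Type where
  kind : SliceKind
  pos : ℕ

namespace Slice

/-- A minimum with `i` strands on its left. -/
def cup (i : ℕ) : Slice := ⟨.cup, i⟩

/-- A maximum with `i` strands on its left. -/
def cap (i : ℕ) : Slice := ⟨.cap, i⟩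

/-- A crossing with `i` strands on its left. -/
def cross (b : Bool) (i : ℕ) : Slice := ⟨.cross b, i⟩

/-- The number of points on the line above the slice, if there are `n` points on the line below. -/
def after (n : ℕ) (p : Slice) : ℕ := n - p.kind.ins + p.kind.outs

/-- The same slice, with `k` more strands on the left. -/
def shift (k : ℕ) (p : Slice) : Slice := ⟨p.kind, k + p.pos⟩

end Slice

/-- The slices `w`, stacked from bottom to top, fit together and lead from `m` points to `n`. -/
def Fits : ℕ → List Slice → ℕ → Prop
  | m, [], n => m = n
  | m, p :: w, n => p.pos + p.kind.ins ≤ m ∧ Fits (p.after m) w n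

theorem Fits.append {m n k : ℕ} {v w : List Slice} (hv : Fits m v n) (hw : Fits n w k) :
    Fits m (v ++ w) k := by
  induction v generalizing m with
  | nil => cases hv; exact hw
  | cons p v ih => exact ⟨hv.1, ih hv.2⟩

theorem Fits.right {m n : ℕ} {v : List Slice} (hv : Fits m v n) (k : ℕ) :
    Fits (m + k) v (n + k) := by
  induction v generalizing m with
  | nil => cases hv; rfl
  | cons p v ih =>
    have h := ih hv.2
    have h1 := hv.1
    refine ⟨by omega, ?_⟩
    have e : p.after (m + k) = p.after m + k := by simp only [Slice.after]; omega
    rw [e]; exact h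

theorem Fits.left {m n : ℕ} {v : List Slice} (hv : Fits m v n) (k : ℕ) :
    Fits (k + m) (v.map (Slice.shift k)) (k + n) := by
  induction v generalizing m with
  | nil => cases hv; rfl
  | cons p v ih =>
    have h := ih hv.2
    have h1 := hv.1
    refine ⟨by simp only [Slice.shift]; omega, ?_⟩
    have e : (p.shift k).after (k + m) = k + p.after m := by
      simp only [Slice.after, Slice.shift]; omega
    rw [e]; exact h

/-- An unoriented tangle diagram with `m` end points at the bottom and `n` at the top. -/
structure Tangle (m n : ℕ) : Type where
  word : List Slice
  fits : Fits m word n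

/-- A link diagram. -/
abbrev LinkDiagram : Type := Tangle 0 0

namespace Tangle

/-- `E` stacked on top of `D`. -/
def stack {m n k : ℕ} (D : Tangle m n) (E : Tangle n k) : Tangle m k :=
  ⟨D.word ++ E.word, D.fits.append E.fits⟩

/-! A tangle with four ends is a diagram in `Tangle 2 2`: its ends NW, NE are at the top and its
ends SW, SE are at the bottom. -/

/-- The sum `S + T`: `T` is placed to the right of `S`, the end NE of `S` is joined to the end NW of
`T`, and the end SE of `S` to the end SW of `T`. -/
def sum (S T : Tangle 2 2) : Tangle 2 2 where
  word := [Slice.cup 1] ++ (S.word ++ T.word.map (Slice.shift 2)) ++ [Slice.cap 1]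
  fits := by
    have h1 : Fits 2 [Slice.cup 1] 4 := by
      simp [Fits, Slice.cup, Slice.after, SliceKind.ins, SliceKind.outs]
    have h2 : Fits 4 [Slice.cap 1] 2 := by
      simp [Fits, Slice.cap, Slice.after, SliceKind.ins, SliceKind.outs]
    exact (h1.append ((S.fits.right 2).append (T.fits.left 2))).append h2

/-- The numerator closure `N(T)`: the ends NW and NE are joined by an arc, and so are the ends SW
and SE. -/
def numerator (T : Tangle 2 2) : LinkDiagram where
  word := [Slice.cup 0] ++ T.word ++ [Slice.cap 0]
  fits := by
    have h1 : Fits 0 [Slice.cup 0] 2 := by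
      simp [Fits, Slice.cup, Slice.after, SliceKind.ins, SliceKind.outs]
    have h2 : Fits 2 [Slice.cap 0] 0 := by
      simp [Fits, Slice.cap, Slice.after, SliceKind.ins, SliceKind.outs]
    exact (h1.append T.fits).append h2

end Tangle

/-! ### Isotopy -/

/-- The moves which generate isotopy of tangles: planar isotopies (distant slices are exchanged, a
minimum cancels against an adjacent maximum, a strand slides across a minimum or a maximum) and the
three Reidemeister moves. -/
inductive Move : List Slice → List Slice → Prop
  | exchange (A B : SliceKind) (i d : ℕ) :
      Move [⟨A, i⟩, ⟨B, i + A.outs + d⟩] [⟨B, i + A.ins + d⟩, ⟨A, i⟩]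
  | zigzag_left (i : ℕ) : Move [Slice.cup i, Slice.cap (i + 1)] []
  | zigzag_right (i : ℕ) : Move [Slice.cup (i + 1), Slice.cap i] []
  | slide_cup (b : Bool) (i : ℕ) :
      Move [Slice.cup i, Slice.cross b (i + 1)] [Slice.cup (i + 1), Slice.cross (!b) i]
  | slide_cap (b : Bool) (i : ℕ) :
      Move [Slice.cross b (i + 1), Slice.cap i] [Slice.cross (!b) i, Slice.cap (i + 1)]
  | reidemeister_one_cup (b : Bool) (i : ℕ) : Move [Slice.cup i, Slice.cross b i] [Slice.cup i]
  | reidemeister_one_cap (b : Bool) (i : ℕ) : Move [Slice.cross b i, Slice.cap i] [Slice.cap i]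
  | reidemeister_two (b : Bool) (i : ℕ) : Move [Slice.cross b i, Slice.cross (!b) i] []
  | reidemeister_three (b : Bool) (i : ℕ) :
      Move [Slice.cross b i, Slice.cross b (i + 1), Slice.cross b i]
        [Slice.cross b (i + 1), Slice.cross b i, Slice.cross b (i + 1)]

namespace Tangle

/-- `E` arises from `D` by a move performed on some consecutive slices. -/
def Step {m n : ℕ} (D E : Tangle m n) : Prop :=
  ∃ v v' a b : List Slice, Move a b ∧ D.word = v ++ a ++ v' ∧ E.word = v ++ b ++ v'

/-- The two diagrams represent isotopic tangles. -/
def Isotopic {m n : ℕ} : Tangle m n → Tangle m n → Prop := Relation.EqvGen Step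

end Tangle

/-- The link is split: it is isotopic to a union of two nonempty links, the diagrams of which are
separated by a line. -/
def Tangle.IsSplit (L : LinkDiagram) : Prop :=
  ∃ L₁ L₂ : LinkDiagram, L₁.word ≠ [] ∧ L₂.word ≠ [] ∧ L.Isotopic (L₁.stack L₂)

/-! ### Strands

The horizontal lines which separate the slices cut the strands at finitely many points.  The pair
`(k, j)` stands for the point number `j` (counted from the left, starting with 0) on line number `k`
(counted from the bottom, starting with 0); the slice number `k` lies between the lines `k` and
`k + 1`.  -/

namespace Tangle

variable {m n : ℕ}

/-- The number of points on line `k`. -/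
def width (D : Tangle m n) (k : ℕ) : ℕ := (D.word.take k).foldl Slice.after m

/-- The set of all points where the diagram meets the separating lines. -/
def points (D : Tangle m n) : Finset (ℕ × ℕ) :=
  (Finset.range (D.word.length + 1)).biUnion
    fun k => (Finset.range (D.width k)).map ⟨fun j => (k, j), fun _ _ h => (Prod.mk.inj h).2⟩

/-- A strand runs vertically through a slice, from the first point to the second. -/
inductive Straight (D : Tangle m n) : ℕ × ℕ → ℕ × ℕ → Prop
  | left (k j : ℕ) (p : Slice) : D.word[k]? = some p → j < p.pos → Straight D (k, j) (k + 1, j)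
  | right (k d : ℕ) (p : Slice) : D.word[k]? = some p →
      Straight D (k, p.pos + p.kind.ins + d) (k + 1, p.pos + p.kind.outs + d)

/-- The over-strand of a crossing runs from the first point up to the second. -/
inductive OverStrand (D : Tangle m n) : ℕ × ℕ → ℕ × ℕ → Prop
  | rising (k i : ℕ) : D.word[k]? = some (Slice.cross true i) → OverStrand D (k, i) (k + 1, i + 1)
  | falling (k i : ℕ) : D.word[k]? = some (Slice.cross false i) →
      OverStrand D (k, i + 1) (k + 1, i)

/-- The under-strand of a crossing runs from the first point up to the second. -/
inductive UnderStrand (D : Tangle m n) : ℕ × ℕ → ℕ × ℕ → Prop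
  | falling (k i : ℕ) : D.word[k]? = some (Slice.cross true i) →
      UnderStrand D (k, i + 1) (k + 1, i)
  | rising (k i : ℕ) : D.word[k]? = some (Slice.cross false i) →
      UnderStrand D (k, i) (k + 1, i + 1)

/-- The two points are joined by a minimum or a maximum. -/
inductive Turn (D : Tangle m n) : ℕ × ℕ → ℕ × ℕ → Prop
  | cup (k i : ℕ) : D.word[k]? = some (Slice.cup i) → Turn D (k + 1, i) (k + 1, i + 1)
  | cap (k i : ℕ) : D.word[k]? = some (Slice.cap i) → Turn D (k, i) (k, i + 1)

/-- The two points follow each other on a strand. -/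
def Adjacent (D : Tangle m n) (a b : ℕ × ℕ) : Prop :=
  D.Straight a b ∨ D.OverStrand a b ∨ D.UnderStrand a b ∨ D.Turn a b

/-- The link has exactly one component. -/
def IsKnot (L : LinkDiagram) : Prop :=
  L.points.Nonempty ∧ ∀ a ∈ L.points, ∀ b ∈ L.points, Relation.EqvGen L.Adjacent a b

/-- An orientation, given by the points at which it is directed upwards. -/
def IsOrientation (D : Tangle m n) (up : ℕ × ℕ → Bool) : Prop :=
  (∀ a b, D.Straight a b ∨ D.OverStrand a b ∨ D.UnderStrand a b → up a = up b) ∧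
    ∀ a b, D.Turn a b → up a ≠ up b

/-! ### The Alexander polynomial -/

/-- The Fox derivatives, abelianized, of the relation `z = y x y⁻¹` between three meridians. -/
noncomputable def foxRow (z x y : ℕ × ℕ) : ℕ × ℕ → ℤ[T;T⁻¹] :=
  Pi.single z 1 - LaurentPolynomial.T 1 • Pi.single x 1
    - (1 - LaurentPolynomial.T 1 : ℤ[T;T⁻¹]) • Pi.single y 1

/-- The rows of the Alexander matrix of the Wirtinger presentation, in which every point gives a
generator.  The meridians at two points are equal if no undercrossing lies between them; at a
crossing, if `y` is the meridian of the over-strand, and `z` and `x` are the meridians of the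
under-strand to the left and to the right of the over-strand, then `z = y x y⁻¹`. -/
inductive AlexanderRow (D : Tangle m n) (up : ℕ × ℕ → Bool) : (ℕ × ℕ → ℤ[T;T⁻¹]) → Prop
  | same (a b : ℕ × ℕ) : D.Straight a b ∨ D.OverStrand a b ∨ D.Turn a b →
      AlexanderRow D up (Pi.single a 1 - Pi.single b 1)
  | rising_up (k i : ℕ) : D.word[k]? = some (Slice.cross true i) → up (k, i) = true →
      AlexanderRow D up (foxRow (k + 1, i) (k, i + 1) (k, i))
  | rising_down (k i : ℕ) : D.word[k]? = some (Slice.cross true i) → up (k, i) = false →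
      AlexanderRow D up (foxRow (k, i + 1) (k + 1, i) (k, i))
  | falling_up (k i : ℕ) : D.word[k]? = some (Slice.cross false i) → up (k, i + 1) = true →
      AlexanderRow D up (foxRow (k, i) (k + 1, i + 1) (k, i + 1))
  | falling_down (k i : ℕ) : D.word[k]? = some (Slice.cross false i) → up (k, i + 1) = false →
      AlexanderRow D up (foxRow (k + 1, i + 1) (k, i) (k, i + 1))

/-- The minors of the Alexander matrix whose size is the number of generators minus one; they
generate the first elementary ideal. -/
def AlexanderMinor (D : Tangle m n) (up : ℕ × ℕ → Bool) (d : ℤ[T;T⁻¹]) : Prop :=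
  ∃ (r : Fin (D.points.card - 1) → ℕ × ℕ → ℤ[T;T⁻¹]) (c : Fin (D.points.card - 1) → ℕ × ℕ),
    (∀ a, D.AlexanderRow up (r a)) ∧ (∀ b, c b ∈ D.points) ∧
      d = (Matrix.of fun a b => r a (c b)).det

/-- `Δ` is the Alexander polynomial of the knot `K`: a greatest common divisor of the minors of the
Alexander matrix (that is, a generator of the smallest principal ideal which contains the first
elementary ideal), well defined up to units of `ℤ[t, t⁻¹]`.  A knot has two orientations; we use the
one for which the first minimum of the diagram is run through from left to right. -/
def IsAlexanderPolynomial (K : LinkDiagram) (Δ : ℤ[T;T⁻¹]) : Prop :=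
  ∃ up : ℕ × ℕ → Bool, K.IsOrientation up ∧ up (1, 0) = false ∧
    ∀ d : ℤ[T;T⁻¹], d ∣ Δ ↔ ∀ μ, K.AlexanderMinor up μ → d ∣ μ

end Tangle

/-!
A complex number `z ≠ 0` is a root of the Alexander polynomial of a knot if and only if the diagram
has a nonconstant coloring by the Alexander quandle `y ▷ x = z x + (1 - z) y`: the rows of the
Alexander matrix annihilate constant vectors, so its minors of corank one all vanish at `z` if and
only if its kernel at `z` contains a nonconstant vector, and passing from the minors to their
greatest common divisor does not change the zeros because the kernel of `ℤ[t] → ℂ, t ↦ z` is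
principal.

A split link has nonconstant colorings: color one part with 1 and the rest with 0, and follow the
coloring through the isotopy.  So `N(S)` and `N(T)` both have one.  If the coloring of `N(S)` takes
different values on the two closing arcs, an affine transformation matches it with the coloring of
`N(T)`; otherwise it matches a constant coloring of `N(T)`.  In both cases the two are glued to a
nonconstant coloring of `N(S + T)`.

For the gluing, an orientation of `N(S + T)` must restrict to orientations of `N(S)` and `N(T)`.
As `N(S)` is split and `N(S + T)` is a knot, the closing arcs of `N(S)` belong to different parts,
and each part of `S` is entered as often as it is left.
-/

/-! ### Colorings by symmetric quandles -/

/-- A quandle with a good involution: `act y x` is the label `x` after passing under a strand with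
label `y`, and `star x` is the label `x` with the direction of its strand reversed. -/
structure SymmetricQuandle (X : Type*) where
  star : X → X
  act : X → X → X
  star_star : ∀ x, star (star x) = x
  act_star : ∀ y x, act y (star x) = star (act y x)
  star_act_act : ∀ y x, act (star y) (act y x) = x
  act_self : ∀ x, act x x = x
  act_act : ∀ x y z, act x (act y z) = act (act x y) (act x z)

namespace SymmetricQuandle

variable {X : Type*} (Q : SymmetricQuandle X) {s t : ℕ → X} {c c' : ℕ → ℕ → X}

theorem act_star_act (y x : X) : Q.act y (Q.act (Q.star y) x) = x := by
  simpa only [Q.star_star] using Q.star_act_act (Q.star y) x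

/-- The condition on the labels `f` below and `g` above a minimum, a maximum or a crossing; they are
numbered from the left, starting with 0. -/
def Vertex : SliceKind → (ℕ → X) → (ℕ → X) → Prop
  | .cup, _, g => g 1 = Q.star (g 0)
  | .cap, f, _ => f 1 = Q.star (f 0)
  | .cross true, f, g => g 0 = Q.act (f 0) (f 1) ∧ g 1 = f 0
  | .cross false, f, g => g 0 = f 1 ∧ g 1 = Q.act (Q.star (f 1)) (f 0)

/-- Compatibility of the labels `s` on the line below a slice with the labels `t` on the line above
it. -/
def Across (p : Slice) (s t : ℕ → X) : Prop :=
  (∀ j < p.pos, t j = s j) ∧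
    (∀ d, t (p.pos + p.kind.outs + d) = s (p.pos + p.kind.ins + d)) ∧
      Q.Vertex p.kind (fun e => s (p.pos + e)) (fun e => t (p.pos + e))

/-- A coloring of a word of slices: `c k j` is the label of the point number `j` on the line number
`k`.  Labels to the right of the diagram are carried along. -/
def IsColoring (w : List Slice) (c : ℕ → ℕ → X) : Prop :=
  ∀ k p, w[k]? = some p → Q.Across p (c k) (c (k + 1))

theorem isColoring_nil (c : ℕ → ℕ → X) : Q.IsColoring [] c := by
  intro k p h
  simp at h

theorem isColoring_cons {p : Slice} {w : List Slice} :
    Q.IsColoring (p :: w) c ↔ Q.Across p (c 0) (c 1) ∧ Q.IsColoring w (fun k => c (k + 1)) := by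
  constructor
  · intro h
    exact ⟨h 0 p rfl, fun k q hq => h (k + 1) q hq⟩
  · rintro ⟨h, h'⟩ (_ | k) q hq
    · cases hq
      exact h
    · exact h' k q hq

theorem isColoring_append {v w : List Slice} :
    Q.IsColoring (v ++ w) c ↔ Q.IsColoring v c ∧ Q.IsColoring w (fun k => c (v.length + k)) := by
  induction v generalizing c with
  | nil => simp [isColoring_nil]
  | cons p v ih =>
    simp only [List.cons_append, isColoring_cons, ih, and_assoc, List.length_cons,
      Nat.add_right_comm _ 1]

variable {Q}

theorem Vertex.congr {A : SliceKind} {f g f' g' : ℕ → X} (h : Q.Vertex A f g)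
    (hf : ∀ e < A.ins, f' e = f e) (hg : ∀ e < A.outs, g' e = g e) : Q.Vertex A f' g' := by
  rcases A with _ | _ | (_ | _) <;> simp_all [Vertex, SliceKind.ins, SliceKind.outs]

theorem IsColoring.congr {w : List Slice} (h : Q.IsColoring w c)
    (hc : ∀ k ≤ w.length, c' k = c k) : Q.IsColoring w c' := by
  intro k p hp
  have hk : k < w.length := (List.getElem?_eq_some_iff.1 hp).1
  rw [hc k hk.le, hc (k + 1) hk]
  exact h k p hp

theorem IsColoring.glue {v w : List Slice} (h : Q.IsColoring v c) (h' : Q.IsColoring w c')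
    (hc : c v.length = c' 0) :
    ∃ d, Q.IsColoring (v ++ w) d ∧ (∀ k ≤ v.length, d k = c k) ∧
      ∀ k, d (v.length + k) = c' k := by
  let d k := if k ≤ v.length then c k else c' (k - v.length)
  have hv : ∀ k ≤ v.length, d k = c k := fun k hk => if_pos hk
  have hw : ∀ k, d (v.length + k) = c' k := by
    rintro (_ | k)
    · simp [d, hc]
    · simp [d]
  exact ⟨d, Q.isColoring_append.2 ⟨h.congr hv, h'.congr fun k _ => hw k⟩, hv, hw⟩

end SymmetricQuandle

/-! ### Turning diagrams upside down -/

/-- The reflection of a minimum, a maximum or a crossing in a horizontal line. -/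
def SliceKind.flip : SliceKind → SliceKind
  | cup => cap
  | cap => cup
  | cross b => cross (!b)

/-- The reflection of a slice in a horizontal line. -/
def Slice.flip (p : Slice) : Slice := ⟨p.kind.flip, p.pos⟩

theorem SliceKind.flip_flip (A : SliceKind) : A.flip.flip = A := by
  cases A <;> simp [flip]

theorem SliceKind.ins_flip (A : SliceKind) : A.flip.ins = A.outs := by
  cases A <;> rfl

theorem SliceKind.outs_flip (A : SliceKind) : A.flip.outs = A.ins := by
  cases A <;> rfl

theorem Slice.flip_flip (p : Slice) : p.flip.flip = p := by
  simp [flip, SliceKind.flip_flip]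

/-- The reflection of a word of slices in a horizontal line. -/
def flipWord (w : List Slice) : List Slice := (w.map Slice.flip).reverse

theorem flipWord_flipWord (w : List Slice) : flipWord (flipWord w) = w := by
  simp [flipWord, Function.comp_def, Slice.flip_flip]

theorem length_flipWord (w : List Slice) : (flipWord w).length = w.length := by
  simp [flipWord]

namespace SymmetricQuandle

variable {X : Type*} (Q : SymmetricQuandle X) {s t : ℕ → X} {c c' : ℕ → ℕ → X}

theorem vertex_flip {A : SliceKind} {f g : ℕ → X} : Q.Vertex A.flip g f ↔ Q.Vertex A f g := by
  rcases A with _ | _ | (_ | _) <;>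
    simp only [SliceKind.flip, Vertex, Bool.not_true, Bool.not_false]
  · constructor
    · rintro ⟨h, h'⟩
      exact ⟨h'.symm, by rw [h, h', Q.star_act_act]⟩
    · rintro ⟨h, h'⟩
      exact ⟨by rw [h', h, Q.act_star_act], h.symm⟩
  · constructor
    · rintro ⟨h, h'⟩
      exact ⟨by rw [h', h, Q.act_star_act], h.symm⟩
    · rintro ⟨h, h'⟩
      exact ⟨h'.symm, by rw [h, h', Q.star_act_act]⟩

theorem across_flip {p : Slice} : Q.Across p.flip t s ↔ Q.Across p s t := by
  simp only [Across, Slice.flip, SliceKind.ins_flip, SliceKind.outs_flip, vertex_flip, eq_comm]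

variable {Q}

theorem IsColoring.flip {w : List Slice} (h : Q.IsColoring w c) :
    Q.IsColoring (flipWord w) (fun k => c (w.length - k)) := by
  intro k p hp
  obtain ⟨hk, rfl⟩ := List.getElem?_eq_some_iff.1 hp
  rw [length_flipWord] at hk
  have hacross := h (w.length - 1 - k) _ (List.getElem?_eq_getElem (by omega))
  simpa [flipWord, across_flip, show w.length - 1 - k + 1 = w.length - k by omega,
    show w.length - (k + 1) = w.length - 1 - k by omega] using hacross

/-! ### Invariance of colorings under isotopy -/

variable (Q)

/-- The labels above a minimum at position `i`, the left leg of which has the label `x`. -/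
def cupped (i : ℕ) (x : X) (s : ℕ → X) (j : ℕ) : X :=
  if j < i then s j else if j = i then x else if j = i + 1 then Q.star x else s (j - 2)

/-- The labels above a crossing at position `i`. -/
def crossed (b : Bool) (i : ℕ) (s : ℕ → X) (j : ℕ) : X :=
  if j = i then (if b then Q.act (s i) (s (i + 1)) else s (i + 1))
  else if j = i + 1 then (if b then s i else Q.act (Q.star (s (i + 1))) (s i))
  else s j

theorem across_cup {i : ℕ} : Q.Across (Slice.cup i) s t ↔ ∃ x, t = Q.cupped i x s := by
  simp only [Across, Slice.cup, SliceKind.ins, SliceKind.outs, Vertex, add_zero]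
  constructor
  · rintro ⟨hl, hr, hx⟩
    refine ⟨t i, funext fun j => ?_⟩
    rcases lt_or_ge j (i + 2) with hj | hj
    · grind [cupped]
    · obtain ⟨d, rfl⟩ := Nat.exists_eq_add_of_le hj
      grind [cupped]
  · rintro ⟨x, rfl⟩
    grind [cupped]

theorem across_cap {i : ℕ} : Q.Across (Slice.cap i) s t ↔ ∃ x, s = Q.cupped i x t := by
  rw [← across_cup, ← across_flip]
  rfl

theorem across_cross {b : Bool} {i : ℕ} :
    Q.Across (Slice.cross b i) s t ↔ t = Q.crossed b i s := by
  simp only [Across, Slice.cross, SliceKind.ins, SliceKind.outs]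
  constructor
  · rintro ⟨hl, hr, hx⟩
    funext j
    rcases lt_or_ge j (i + 2) with hj | hj
    · cases b <;> grind [crossed, Vertex]
    · obtain ⟨d, rfl⟩ := Nat.exists_eq_add_of_le hj
      grind [crossed]
  · rintro rfl
    cases b <;> grind [crossed, Vertex]

theorem crossed_cupped (b : Bool) (i : ℕ) (x : X) (s : ℕ → X) :
    Q.crossed b i (Q.cupped i x s) = Q.cupped i (Q.star x) s := by
  have hx := Q.act_self x
  have hstar := Q.act_star x x
  funext j
  grind [crossed, cupped, Q.star_star]

theorem crossed_not_crossed (b : Bool) (i : ℕ) (s : ℕ → X) :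
    Q.crossed (!b) i (Q.crossed b i s) = s := by
  funext j
  cases b <;> grind [crossed, Q.star_act_act, Q.act_star_act]

theorem crossed_braid (b : Bool) (i : ℕ) (s : ℕ → X) :
    Q.crossed b i (Q.crossed b (i + 1) (Q.crossed b i s)) =
      Q.crossed b (i + 1) (Q.crossed b i (Q.crossed b (i + 1) s)) := by
  have hact := Q.act_act (s i) (s (i + 1)) (s (i + 2))
  have hact' := Q.act_act (Q.star (s (i + 2))) (Q.star (s (i + 1))) (s i)
  have hstar := Q.act_star (Q.star (s (i + 2))) (s (i + 1))
  funext j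
  cases b <;> grind [crossed]

theorem eq_of_cupped_eq_cupped_succ {i : ℕ} {x y : X}
    (h : Q.cupped i x s = Q.cupped (i + 1) y t) : s = t ∧ x = t i := by
  have hj := congrFun h
  have hx : x = t i := by simpa [cupped] using hj i
  refine ⟨funext fun j => ?_, hx⟩
  have h₁ := hj (i + 1)
  have h₂ := hj (i + 2)
  have h₃ := hj j
  have h₄ := hj (j + 2)
  grind [cupped, Q.star_star]

theorem cupped_succ_star (i : ℕ) (s : ℕ → X) :
    Q.cupped i (s i) s = Q.cupped (i + 1) (Q.star (s i)) s := by
  funext j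
  grind [cupped, Q.star_star]

/-- The word `w` has a coloring with labels `s` at the bottom and `t` at the top. -/
def AcrossWord (w : List Slice) (s t : ℕ → X) : Prop :=
  ∃ c, Q.IsColoring w c ∧ c 0 = s ∧ c w.length = t

/-- A coloring of `w` is determined by its labels at the bottom and at the top. -/
def Rigid (w : List Slice) : Prop :=
  ∀ c c', Q.IsColoring w c → Q.IsColoring w c' → c 0 = c' 0 → c w.length = c' w.length →
    ∀ k ≤ w.length, c k = c' k

theorem acrossWord_nil : Q.AcrossWord [] s t ↔ t = s := by
  constructor
  · rintro ⟨c, -, rfl, rfl⟩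
    rfl
  · rintro rfl
    exact ⟨fun _ => t, Q.isColoring_nil _, rfl, rfl⟩

theorem acrossWord_cons {p : Slice} {w : List Slice} :
    Q.AcrossWord (p :: w) s t ↔ ∃ u, Q.Across p s u ∧ Q.AcrossWord w u t := by
  constructor
  · rintro ⟨c, hc, rfl, rfl⟩
    obtain ⟨hp, hw⟩ := Q.isColoring_cons.1 hc
    exact ⟨c 1, hp, _, hw, rfl, rfl⟩
  · rintro ⟨u, hp, c, hc, rfl, rfl⟩
    exact ⟨fun k => k.casesOn s c, Q.isColoring_cons.2 ⟨hp, hc⟩, rfl, rfl⟩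

theorem acrossWord_pair {p q : Slice} :
    Q.AcrossWord [p, q] s t ↔ ∃ u, Q.Across p s u ∧ Q.Across q u t := by
  simp only [acrossWord_cons, acrossWord_nil, exists_eq_right']

theorem acrossWord_flipWord {w : List Slice} :
    Q.AcrossWord (flipWord w) t s ↔ Q.AcrossWord w s t := by
  have flip {v : List Slice} {s t : ℕ → X} (h : Q.AcrossWord v s t) :
      Q.AcrossWord (flipWord v) t s := by
    obtain ⟨c, hc, rfl, rfl⟩ := h
    exact ⟨_, hc.flip, by simp, by simp [length_flipWord]⟩
  exact ⟨fun h => flipWord_flipWord w ▸ flip h, flip⟩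

theorem rigid_nil : Q.Rigid [] := by
  intro c c' _ _ h _ k hk
  obtain rfl : k = 0 := by simpa using hk
  exact h

theorem rigid_singleton (p : Slice) : Q.Rigid [p] := by
  intro c c' _ _ h h' k hk
  obtain rfl | rfl : k = 0 ∨ k = 1 := Nat.le_one_iff_eq_zero_or_eq_one.1 hk
  exacts [h, h']

variable {Q}

theorem Rigid.flip {w : List Slice} (h : Q.Rigid w) : Q.Rigid (flipWord w) := by
  intro c c' hc hc' h₀ h₁ k hk
  rw [length_flipWord] at h₁ hk
  have hflip := h _ _ (flipWord_flipWord w ▸ hc.flip) (flipWord_flipWord w ▸ hc'.flip)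
    (by simpa [length_flipWord] using h₁) (by simpa [length_flipWord] using h₀)
    (w.length - k) (by omega)
  simpa [length_flipWord, Nat.sub_sub_self hk] using hflip

theorem Rigid.cross_cons {b : Bool} {i : ℕ} {w : List Slice} (h : Q.Rigid w) :
    Q.Rigid (Slice.cross b i :: w) := by
  intro c c' hc hc' h₀ h₁ k hk
  rw [isColoring_cons, across_cross] at hc hc'
  rcases k with _ | k
  · exact h₀
  · exact h _ _ hc.2 hc'.2 (by simp only [zero_add, hc.1, hc'.1, h₀]) h₁ k (by simpa using hk)

theorem rigid_pair {p q : Slice}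
    (h : ∀ s t u v, Q.Across p s u → Q.Across q u t → Q.Across p s v → Q.Across q v t → u = v) :
    Q.Rigid [p, q] := by
  intro c c' hc hc' h₀ h₂ k hk
  simp only [isColoring_cons, isColoring_nil, and_true, zero_add, Nat.reduceAdd] at hc hc'
  simp only [List.length_cons, List.length_nil, zero_add, Nat.reduceAdd] at h₂ hk
  interval_cases k
  exacts [h₀, h _ _ _ _ hc.1 hc.2 (h₀ ▸ hc'.1) (h₂ ▸ hc'.2), h₂]

variable (Q)

theorem across_exchange {A B : SliceKind} {i d : ℕ} {s u t : ℕ → X}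
    (hA : Q.Across ⟨A, i⟩ s u) (hB : Q.Across ⟨B, i + A.outs + d⟩ u t) :
    ∃ v, Q.Across ⟨B, i + A.ins + d⟩ s v ∧ Q.Across ⟨A, i⟩ v t := by
  obtain ⟨leftA, rightA, vertexA⟩ := hA
  obtain ⟨leftB, rightB, vertexB⟩ := hB
  dsimp only at leftA rightA vertexA leftB rightB vertexB
  have rightA' (j) : u (i + A.outs + d + j) = s (i + A.ins + d + j) := by
    simpa only [add_assoc] using rightA (d + j)
  let v j := if j < i + A.ins + d then s j else t (j - A.ins + A.outs)
  have hl {j} (hj : j < i + A.ins + d) : v j = s j := if_pos hj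
  have hr (j) : v (i + A.ins + d + j) = t (i + A.outs + d + j) := by
    simp only [v, if_neg (show ¬ i + A.ins + d + j < i + A.ins + d by omega)]
    congr 1
    omega
  refine ⟨v, ⟨fun j hj => hl hj, fun j => ?_,
    vertexB.congr (fun j _ => (rightA' j).symm) fun j _ => hr j⟩, fun j hj => ?_, fun j => ?_,
    vertexA.congr (fun j hj => hl (by dsimp only; omega))
      fun j hj => leftB _ (by dsimp only; omega)⟩
  · dsimp only
    rw [add_assoc, hr, ← add_assoc, rightB, add_assoc _ B.ins, rightA', ← add_assoc]
  · dsimp only at hj ⊢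
    rw [hl (by omega), leftB _ (by omega), leftA _ hj]
  · dsimp only
    rcases lt_or_ge j d with hj | hj
    · rw [hl (by omega), leftB _ (by omega), rightA]
    · obtain ⟨e, rfl⟩ := Nat.exists_eq_add_of_le hj
      rw [← add_assoc, ← add_assoc, hr]

theorem rigid_exchange (A B : SliceKind) (i d : ℕ) :
    Q.Rigid [⟨A, i⟩, ⟨B, i + A.outs + d⟩] := by
  refine Q.rigid_pair fun s t u v hA hB hA' hB' => funext fun j => ?_
  rcases lt_or_ge j (i + A.outs) with hj | hj
  · rw [← hB.1 j (by dsimp only; omega), ← hB'.1 j (by dsimp only; omega)]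
  · obtain ⟨e, rfl⟩ := Nat.exists_eq_add_of_le hj
    exact (hA.2.1 e).trans (hA'.2.1 e).symm

/-- The two words have the same colorings, up to their labels at the bottom and at the top, and
these labels determine the colorings. -/
structure Interchangeable (v w : List Slice) : Prop where
  acrossWord_iff : ∀ s t, Q.AcrossWord v s t ↔ Q.AcrossWord w s t
  rigid_left : Q.Rigid v
  rigid_right : Q.Rigid w

namespace Interchangeable

variable {Q} {v w : List Slice}

theorem symm (h : Q.Interchangeable v w) : Q.Interchangeable w v :=
  ⟨fun s t => (h.acrossWord_iff s t).symm, h.rigid_right, h.rigid_left⟩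

theorem flip (h : Q.Interchangeable v w) : Q.Interchangeable (flipWord v) (flipWord w) :=
  ⟨fun s t => by simpa only [acrossWord_flipWord] using h.acrossWord_iff t s,
    h.rigid_left.flip, h.rigid_right.flip⟩

end Interchangeable

theorem interchangeable_exchange (A B : SliceKind) (i d : ℕ) :
    Q.Interchangeable [⟨A, i⟩, ⟨B, i + A.outs + d⟩] [⟨B, i + A.ins + d⟩, ⟨A, i⟩] := by
  have forward (A B : SliceKind) (s t : ℕ → X)
      (h : Q.AcrossWord [⟨A, i⟩, ⟨B, i + A.outs + d⟩] s t) :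
      Q.AcrossWord [⟨B, i + A.ins + d⟩, ⟨A, i⟩] s t := by
    rw [acrossWord_pair] at h ⊢
    obtain ⟨u, hA, hB⟩ := h
    exact Q.across_exchange hA hB
  have flip (A B : SliceKind) : flipWord [⟨A.flip, i⟩, ⟨B.flip, i + A.flip.outs + d⟩] =
      [⟨B, i + A.ins + d⟩, ⟨A, i⟩] := by
    simp [flipWord, Slice.flip, SliceKind.flip_flip, SliceKind.outs_flip]
  refine ⟨fun s t => ⟨forward A B s t, fun h => ?_⟩, Q.rigid_exchange A B i d,
    flip A B ▸ (Q.rigid_exchange A.flip B.flip i d).flip⟩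
  rw [← flip, acrossWord_flipWord] at h
  rw [← acrossWord_flipWord]
  simpa [flipWord, Slice.flip, SliceKind.ins_flip] using forward A.flip B.flip t s h

theorem interchangeable_zigzag (i : ℕ) :
    Q.Interchangeable [Slice.cup i, Slice.cap (i + 1)] [] := by
  refine ⟨fun s t => ?_, Q.rigid_pair fun s t u v hcup hcap hcup' hcap' => ?_, Q.rigid_nil⟩
  · simp only [acrossWord_pair, acrossWord_nil, across_cup, across_cap]
    constructor
    · rintro ⟨_, ⟨x, rfl⟩, y, h⟩
      exact (Q.eq_of_cupped_eq_cupped_succ h).1.symm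
    · rintro rfl
      exact ⟨_, ⟨t i, rfl⟩, _, Q.cupped_succ_star i t⟩
  · simp only [across_cup, across_cap] at hcup hcap hcup' hcap'
    obtain ⟨x, rfl⟩ := hcup
    obtain ⟨x', rfl⟩ := hcup'
    obtain ⟨y, hy⟩ := hcap
    obtain ⟨y', hy'⟩ := hcap'
    rw [(Q.eq_of_cupped_eq_cupped_succ hy).2, (Q.eq_of_cupped_eq_cupped_succ hy').2]

theorem rigid_cup_cross (b : Bool) (i k : ℕ) : Q.Rigid [Slice.cup i, Slice.cross b k] := by
  have h := (Q.rigid_singleton (Slice.cap i)).cross_cons (b := !b) (i := k) |>.flip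
  simpa [flipWord, Slice.flip, SliceKind.flip, Slice.cap, Slice.cup, Slice.cross] using h

theorem acrossWord_cup_cross {b : Bool} {i k : ℕ} :
    Q.AcrossWord [Slice.cup i, Slice.cross b k] s t ↔ ∃ x, t = Q.crossed b k (Q.cupped i x s) := by
  rw [acrossWord_pair]
  simp only [across_cup, across_cross]
  exact ⟨fun ⟨_, ⟨x, rfl⟩, h⟩ => ⟨x, h⟩, fun ⟨x, h⟩ => ⟨_, ⟨x, rfl⟩, h⟩⟩

theorem exists_crossed_succ_cupped (b : Bool) (i : ℕ) :
    (∃ x, t = Q.crossed b (i + 1) (Q.cupped i x s)) ↔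
      ∃ x, t = Q.crossed (!b) i (Q.cupped (i + 1) x s) := by
  have slide (x : X) : Q.crossed b (i + 1) (Q.cupped i x s) = Q.crossed (!b) i
      (Q.cupped (i + 1) (if b then x else Q.act (Q.star (s i)) x) s) := by
    have := Q.act_star (Q.star (s i)) x
    have := Q.act_star x (s i)
    funext j
    cases b <;> grind [crossed, cupped, Q.star_star, Q.act_star_act, Q.star_act_act]
  constructor
  · rintro ⟨x, rfl⟩
    exact ⟨_, slide x⟩
  · rintro ⟨x, rfl⟩
    refine ⟨if b then x else Q.act (s i) x, ?_⟩
    rw [slide]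
    cases b <;> simp [Q.star_act_act]

theorem interchangeable_slide (b : Bool) (i : ℕ) :
    Q.Interchangeable [Slice.cup i, Slice.cross b (i + 1)]
      [Slice.cup (i + 1), Slice.cross (!b) i] := by
  refine ⟨fun s t => ?_, Q.rigid_cup_cross _ _ _, Q.rigid_cup_cross _ _ _⟩
  simpa only [acrossWord_cup_cross] using Q.exists_crossed_succ_cupped b i

theorem interchangeable_curl (b : Bool) (i : ℕ) :
    Q.Interchangeable [Slice.cup i, Slice.cross b i] [Slice.cup i] := by
  refine ⟨fun s t => ?_, Q.rigid_cup_cross _ _ _, Q.rigid_singleton _⟩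
  rw [acrossWord_cup_cross, acrossWord_cons]
  simp only [acrossWord_nil, across_cup, exists_eq_right', crossed_cupped]
  exact ⟨fun ⟨x, h⟩ => ⟨_, h⟩, fun ⟨x, h⟩ => ⟨Q.star x, by rw [Q.star_star, h]⟩⟩

theorem interchangeable_cross_cross (b : Bool) (i : ℕ) :
    Q.Interchangeable [Slice.cross b i, Slice.cross (!b) i] [] := by
  refine ⟨fun s t => ?_, Q.rigid_nil.cross_cons.cross_cons, Q.rigid_nil⟩
  simp only [acrossWord_cons, across_cross, exists_eq_left, crossed_not_crossed]

theorem interchangeable_braid (b : Bool) (i : ℕ) :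
    Q.Interchangeable [Slice.cross b i, Slice.cross b (i + 1), Slice.cross b i]
      [Slice.cross b (i + 1), Slice.cross b i, Slice.cross b (i + 1)] := by
  refine ⟨fun s t => ?_, Q.rigid_nil.cross_cons.cross_cons.cross_cons,
    Q.rigid_nil.cross_cons.cross_cons.cross_cons⟩
  simp only [acrossWord_cons, across_cross, exists_eq_left, crossed_braid]

theorem interchangeable_of_move {v w : List Slice} (h : Move v w) : Q.Interchangeable v w := by
  cases h with
  | exchange A B i d => exact Q.interchangeable_exchange A B i d
  | zigzag_left i => exact Q.interchangeable_zigzag i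
  | zigzag_right i => exact (Q.interchangeable_zigzag i).flip
  | slide_cup b i => exact Q.interchangeable_slide b i
  | slide_cap b i =>
    cases b
    exacts [(Q.interchangeable_slide true i).flip, (Q.interchangeable_slide false i).flip]
  | reidemeister_one_cup b i => exact Q.interchangeable_curl b i
  | reidemeister_one_cap b i =>
    cases b
    exacts [(Q.interchangeable_curl true i).flip, (Q.interchangeable_curl false i).flip]
  | reidemeister_two b i => exact Q.interchangeable_cross_cross b i
  | reidemeister_three b i => exact Q.interchangeable_braid b i

variable {Q}

theorem IsColoring.replace {a b v w : List Slice} (h : Q.Interchangeable a b)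
    (hc : Q.IsColoring (v ++ a ++ w) c) :
    ∃ c', Q.IsColoring (v ++ b ++ w) c' ∧ (∀ k ≤ v.length, c' k = c k) ∧
      ∀ k, c' (v.length + b.length + k) = c (v.length + a.length + k) := by
  simp only [isColoring_append, List.length_append] at hc
  obtain ⟨⟨hv, ha⟩, hw⟩ := hc
  obtain ⟨c₁, hc₁, hbot, htop⟩ := (h.acrossWord_iff _ _).1 ⟨_, ha, rfl, rfl⟩
  obtain ⟨c₂, hc₂, hlow, hhigh⟩ := hv.glue hc₁ hbot.symm
  obtain ⟨c₃, hc₃, hlow', hhigh'⟩ := hc₂.glue hw (by rw [List.length_append, hhigh, htop]; rfl)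
  rw [List.length_append] at hlow' hhigh'
  exact ⟨c₃, hc₃, fun k hk => by rw [hlow' k (by omega), hlow k hk], hhigh'⟩

theorem Rigid.eq_of_isColoring {a v w : List Slice} (h : Q.Rigid a)
    (hc : Q.IsColoring (v ++ a ++ w) c) (hc' : Q.IsColoring (v ++ a ++ w) c')
    (hlow : ∀ k ≤ v.length, c k = c' k)
    (hhigh : ∀ k ≤ w.length, c (v.length + a.length + k) = c' (v.length + a.length + k)) :
    ∀ k ≤ (v ++ a ++ w).length, c k = c' k := by
  simp only [isColoring_append, List.length_append] at hc hc'
  have hmid := h _ _ hc.1.2 hc'.1.2 (hlow _ le_rfl) (hhigh 0 (Nat.zero_le _))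
  intro k hk
  simp only [List.length_append] at hk
  rcases le_total k v.length with hkv | hkv
  · exact hlow k hkv
  · obtain ⟨e, rfl⟩ := Nat.exists_eq_add_of_le hkv
    rcases le_total e a.length with he | he
    · exact hmid e he
    · obtain ⟨f, rfl⟩ := Nat.exists_eq_add_of_le he
      simpa only [add_assoc] using hhigh f (by omega)

end SymmetricQuandle

/-! ### Widths and juxtaposition -/

/-- The number of points on the line number `k`, if there are `m` points at the bottom. -/
def lineWidth (m : ℕ) (w : List Slice) (k : ℕ) : ℕ := (w.take k).foldl Slice.after m

theorem lineWidth_zero (m : ℕ) (w : List Slice) : lineWidth m w 0 = m := rfl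

theorem lineWidth_cons_succ (m : ℕ) (p : Slice) (w : List Slice) (k : ℕ) :
    lineWidth m (p :: w) (k + 1) = lineWidth (p.after m) w k := rfl

theorem lineWidth_append_left (m : ℕ) {v : List Slice} (w : List Slice) {k : ℕ}
    (hk : k ≤ v.length) : lineWidth m (v ++ w) k = lineWidth m v k := by
  rw [lineWidth, lineWidth, List.take_append_of_le_length hk]

theorem lineWidth_append_right (m : ℕ) (v w : List Slice) (k : ℕ) :
    lineWidth m (v ++ w) (v.length + k) = lineWidth (lineWidth m v v.length) w k := by
  rw [lineWidth, lineWidth, lineWidth, List.take_length_add_append, List.foldl_append,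
    List.take_length]

namespace Fits

variable {m m' n : ℕ} {v w : List Slice}

theorem lineWidth_length (h : Fits m w n) : lineWidth m w w.length = n := by
  induction w generalizing m with
  | nil => exact h
  | cons p w ih => exact ih h.2

theorem exists_of_append (h : Fits m (v ++ w) n) : ∃ l, Fits m v l ∧ Fits l w n := by
  induction v generalizing m with
  | nil => exact ⟨m, rfl, h⟩
  | cons p v ih =>
    obtain ⟨l, hv, hw⟩ := ih h.2
    exact ⟨l, ⟨h.1, hv⟩, hw⟩

theorem left_unique (h : Fits m w n) (h' : Fits m' w n) : m = m' := by
  induction w generalizing m m' with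
  | nil => exact h.trans h'.symm
  | cons p w ih =>
    have hins := h.1
    have hins' := h'.1
    have hafter := ih h.2 h'.2
    simp only [Slice.after] at hafter
    omega

theorem exists_lineWidth_eq (h : Fits m w n) {k : ℕ} {p : Slice} (hp : w[k]? = some p) :
    ∃ r, lineWidth m w k = p.pos + p.kind.ins + r ∧
      lineWidth m w (k + 1) = p.pos + p.kind.outs + r := by
  induction w generalizing m k with
  | nil => simp at hp
  | cons q w ih =>
    rcases k with _ | k
    · obtain rfl : q = p := by simpa using hp
      have hins := h.1
      refine ⟨m - (q.pos + q.kind.ins), ?_, ?_⟩ <;>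
        simp only [lineWidth_zero, lineWidth_cons_succ, Slice.after] <;> omega
    · exact ih h.2 hp

theorem lineWidth_right (h : Fits m w n) (r k : ℕ) :
    lineWidth (m + r) w k = lineWidth m w k + r := by
  induction w generalizing m k with
  | nil => simp [lineWidth]
  | cons p w ih =>
    rcases k with _ | k
    · rfl
    · have hins := h.1
      rw [lineWidth_cons_succ, lineWidth_cons_succ, ← ih h.2]
      congr 1
      simp only [Slice.after]
      omega

theorem lineWidth_left (h : Fits m w n) (r k : ℕ) :
    lineWidth (r + m) (w.map (Slice.shift r)) k = r + lineWidth m w k := by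
  induction w generalizing m k with
  | nil => simp [lineWidth]
  | cons p w ih =>
    rcases k with _ | k
    · rfl
    · have hins := h.1
      rw [List.map_cons, lineWidth_cons_succ, lineWidth_cons_succ, ← ih h.2]
      congr 1
      simp only [Slice.after, Slice.shift]
      omega

theorem lineWidth_one_pos (h : Fits 0 w n) (hw : w ≠ []) : 0 < lineWidth 0 w 1 := by
  obtain ⟨⟨A, i⟩, w, rfl⟩ := List.exists_cons_of_ne_nil hw
  have hins := h.1
  rcases A with _ | _ | _ <;> simp_all [lineWidth, Slice.after, SliceKind.ins, SliceKind.outs]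

end Fits

/-- The first `n` labels of `s`, followed by the labels of `t`. -/
def beside {X : Type*} (n : ℕ) (s t : ℕ → X) (j : ℕ) : X := if j < n then s j else t (j - n)

theorem beside_of_lt {X : Type*} {n j : ℕ} (s t : ℕ → X) (hj : j < n) : beside n s t j = s j :=
  if_pos hj

theorem beside_add {X : Type*} (n : ℕ) (s t : ℕ → X) (j : ℕ) : beside n s t (n + j) = t j := by
  simp [beside]

namespace SymmetricQuandle

variable {X Y Z : Type*} {Q : SymmetricQuandle X} {R : SymmetricQuandle Y} {U : SymmetricQuandle Z}
  {s t u : ℕ → X} {c d : ℕ → ℕ → X} {m n r : ℕ} {p : Slice} {v w : List Slice}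

theorem Across.beside_right (h : Q.Across p s t) (r : ℕ) (u : ℕ → X) :
    Q.Across p (beside (p.pos + p.kind.ins + r) s u) (beside (p.pos + p.kind.outs + r) t u) := by
  obtain ⟨left, right, vertex⟩ := h
  refine ⟨fun j hj => ?_, fun e => ?_, vertex.congr (fun e he => beside_of_lt _ _ (by omega))
    fun e he => beside_of_lt _ _ (by omega)⟩
  · rw [beside_of_lt _ _ (by omega), beside_of_lt _ _ (by omega), left j hj]
  · rcases lt_or_ge e r with he | he
    · rw [beside_of_lt _ _ (by omega), beside_of_lt _ _ (by omega), right]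
    · obtain ⟨f, rfl⟩ := Nat.exists_eq_add_of_le he
      rw [← add_assoc, ← add_assoc, beside_add, beside_add]

theorem Across.beside_left (h : Q.Across p s t) (r : ℕ) (u : ℕ → X) :
    Q.Across (p.shift r) (beside r u s) (beside r u t) := by
  obtain ⟨left, right, vertex⟩ := h
  simp only [Across, Slice.shift, add_assoc, beside_add] at right ⊢
  refine ⟨fun j hj => ?_, right, vertex⟩
  rcases lt_or_ge j r with hjr | hjr
  · rw [beside_of_lt _ _ hjr, beside_of_lt _ _ hjr]
  · obtain ⟨e, rfl⟩ := Nat.exists_eq_add_of_le hjr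
    rw [beside_add, beside_add, left e (by omega)]

theorem Across.of_shift (h : Q.Across (p.shift r) s t) :
    Q.Across p (fun j => s (r + j)) (fun j => t (r + j)) := by
  obtain ⟨left, right, vertex⟩ := h
  simp only [Slice.shift, add_assoc] at left right vertex
  exact ⟨fun j hj => left _ (by omega), by simpa only [add_assoc] using right, vertex⟩

theorem IsColoring.apply_lineWidth_add (h : Fits m w n) (hc : Q.IsColoring w c) {k : ℕ}
    (hk : k ≤ w.length) (e : ℕ) : c k (lineWidth m w k + e) = c 0 (m + e) := by
  induction k with
  | zero => rfl
  | succ k ih =>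
    have hp := List.getElem?_eq_getElem hk
    obtain ⟨r, hr, hr'⟩ := h.exists_lineWidth_eq hp
    rw [← ih (by omega), hr, hr']
    simpa only [add_assoc] using (hc k _ hp).2.1 (r + e)

theorem IsColoring.apply_of_lt (hc : Q.IsColoring (w.map (Slice.shift r)) c) {j k : ℕ}
    (hk : k ≤ w.length) (hj : j < r) : c k j = c 0 j := by
  induction k with
  | zero => rfl
  | succ k ih =>
    have hp : (w.map (Slice.shift r))[k]? = some (w[k].shift r) := by simp [Nat.lt_of_succ_le hk]
    rw [← ih (by omega)]
    exact (hc k _ hp).1 j (by simp only [Slice.shift]; omega)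

theorem IsColoring.beside_right (h : Fits m w n) (hc : Q.IsColoring w c) (t : ℕ → X) :
    Q.IsColoring w (fun k => beside (lineWidth m w k) (c k) t) := by
  intro k p hp
  obtain ⟨r, hr, hr'⟩ := h.exists_lineWidth_eq hp
  simp only [hr, hr']
  exact (hc k p hp).beside_right r t

theorem IsColoring.beside_left (hc : Q.IsColoring w c) (r : ℕ) (t : ℕ → X) :
    Q.IsColoring (w.map (Slice.shift r)) (fun k => beside r t (c k)) := by
  intro k p hp
  rw [List.getElem?_map, Option.map_eq_some_iff] at hp
  obtain ⟨p, hp, rfl⟩ := hp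
  exact (hc k p hp).beside_left r t

theorem IsColoring.of_shift (hc : Q.IsColoring (w.map (Slice.shift r)) c) :
    Q.IsColoring w (fun k j => c k (r + j)) :=
  fun k p hp => (hc k (p.shift r) (by rw [List.getElem?_map, hp]; rfl)).of_shift

theorem IsColoring.exists_beside (h : Fits m v n) (hc : Q.IsColoring v c)
    (hd : Q.IsColoring w d) :
    ∃ e, Q.IsColoring (v ++ w.map (Slice.shift n)) e ∧
      (∀ k ≤ v.length, e k = beside (lineWidth m v k) (c k) (d 0)) ∧
      ∀ k, e (v.length + k) = beside n (c v.length) (d k) :=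
  (hc.beside_right h (d 0)).glue (hd.beside_left n (c v.length)) (by rw [h.lineWidth_length])

theorem IsColoring.map₂ {f : X → Y → Z} {c' : ℕ → ℕ → Y} (hc : Q.IsColoring w c)
    (hc' : R.IsColoring w c') (hstar : ∀ x y, f (Q.star x) (R.star y) = U.star (f x y))
    (hact : ∀ x x' y y', f (Q.act x x') (R.act y y') = U.act (f x y) (f x' y')) :
    U.IsColoring w (fun k j => f (c k j) (c' k j)) := by
  intro k p hp
  obtain ⟨left, right, vertex⟩ := hc k p hp
  obtain ⟨left', right', vertex'⟩ := hc' k p hp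
  refine ⟨fun j hj => congrArg₂ f (left j hj) (left' j hj),
    fun e => congrArg₂ f (right e) (right' e), ?_⟩
  rcases p with ⟨_ | _ | (_ | _), i⟩ <;> simp_all only [Vertex, and_self]

theorem IsColoring.map {f : X → Y} (hc : Q.IsColoring w c)
    (hstar : ∀ x, f (Q.star x) = R.star (f x))
    (hact : ∀ x y, f (Q.act x y) = R.act (f x) (f y)) :
    R.IsColoring w (fun k j => f (c k j)) :=
  hc.map₂ (f := fun x _ => f x) hc (fun x _ => hstar x) fun x y _ _ => hact x y

/-- The symmetric quandle in which strands do not act on each other. -/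
def ofInvolution (f : X → X) (hf : Function.Involutive f) : SymmetricQuandle X where
  star := f
  act _ x := x
  star_star := hf
  act_star _ _ := rfl
  star_act_act _ _ := rfl
  act_self _ := rfl
  act_act _ _ _ := rfl

end SymmetricQuandle

/-! ### Alexander colorings -/

/-- The set of all labels which a coloring of the diagram uses. -/
def Tangle.labels {X : Type*} {m n : ℕ} (D : Tangle m n) (c : ℕ → ℕ → X) : Set X :=
  (fun p => c p.1 p.2) '' (D.points : Set (ℕ × ℕ))

theorem Tangle.mem_points {m n : ℕ} {D : Tangle m n} {k j : ℕ} :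
    (k, j) ∈ D.points ↔ k ≤ D.word.length ∧ j < lineWidth m D.word k := by
  simp only [points, Finset.mem_biUnion, Finset.mem_range, Finset.mem_map]
  constructor
  · rintro ⟨k, hk, j, hj, h⟩
    obtain ⟨rfl, rfl⟩ := Prod.mk.inj h
    exact ⟨by omega, hj⟩
  · rintro ⟨hk, hj⟩
    exact ⟨k, by omega, j, hj, rfl⟩

theorem Tangle.mem_labels {X : Type*} {m n : ℕ} {D : Tangle m n} {c : ℕ → ℕ → X} {x : X} :
    x ∈ D.labels c ↔ ∃ k ≤ D.word.length, ∃ j < lineWidth m D.word k, c k j = x := by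
  simp only [labels, Set.mem_image, SetLike.mem_coe, Prod.exists, mem_points]
  grind

theorem Tangle.lineWidth_replace {m n : ℕ} {D E : Tangle m n} {a b v w : List Slice}
    (hD : D.word = v ++ a ++ w) (hE : E.word = v ++ b ++ w) :
    (∀ k ≤ v.length, lineWidth m D.word k = lineWidth m E.word k) ∧
      ∀ k, lineWidth m D.word (v.length + a.length + k) =
        lineWidth m E.word (v.length + b.length + k) := by
  obtain ⟨l, hl, hlw⟩ := Fits.exists_of_append (hD ▸ D.fits)
  obtain ⟨l', hl', hlw'⟩ := Fits.exists_of_append (hE ▸ E.fits)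
  rw [hD, hE]
  refine ⟨fun k hk => ?_, fun k => ?_⟩
  · simp only [List.append_assoc, lineWidth_append_left _ _ hk]
  · rw [← List.length_append, ← List.length_append, lineWidth_append_right,
      lineWidth_append_right, hl.lineWidth_length, hl'.lineWidth_length, hlw.left_unique hlw']

/-- An involution of the directions `B` of strands, and for each direction the factor by which the
Alexander quandle scales labels that pass under a strand with this direction.  For oriented strands
`B` is `Bool`; with the trivial weights the labels are just locally constant. -/
structure WeightedInvolution (B K : Type*) [Field K] where
  reverse : B → B
  weight : B → Kˣ
  reverse_reverse : ∀ u, reverse (reverse u) = u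
  weight_reverse : ∀ u, weight (reverse u) = (weight u)⁻¹

namespace WeightedInvolution

variable {B K : Type*} [Field K] (A : WeightedInvolution B K)

/-- The symmetric quandle of directions. -/
def directions : SymmetricQuandle B := .ofInvolution A.reverse A.reverse_reverse

/-- The Alexander quandle, with directions. -/
def quandle : SymmetricQuandle (B × K) where
  star x := (A.reverse x.1, x.2)
  act y x := (x.1, A.weight y.1 * x.2 + (1 - A.weight y.1) * y.2)
  star_star x := by simp [A.reverse_reverse]
  act_star _ _ := rfl
  star_act_act y x := by
    have hinv := Units.inv_mul (A.weight y.1)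
    ext
    · rfl
    · simp only [A.weight_reverse]
      linear_combination (x.2 - y.2) * hinv
  act_self x := by
    ext
    · rfl
    · ring
  act_act x y z := by
    ext
    · rfl
    · ring_nf

/-- `c` is an Alexander coloring of a word of slices with the directions `o`. -/
def IsColoring (w : List Slice) (o : ℕ → ℕ → B) (c : ℕ → ℕ → K) : Prop :=
  A.quandle.IsColoring w (fun k j => (o k j, c k j))

variable {A} {m n : ℕ} {a v w : List Slice} {o : ℕ → ℕ → B} {c : ℕ → ℕ → K}

theorem IsColoring.directions (h : A.IsColoring w o c) : A.directions.IsColoring w o :=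
  SymmetricQuandle.IsColoring.map (f := Prod.fst) h (fun _ => rfl) fun _ _ => rfl

theorem isColoring_const (h : A.directions.IsColoring w o) (x : K) :
    A.IsColoring w o (fun _ _ => x) :=
  h.map (f := fun u => (u, x)) (fun _ => rfl)
    fun _ _ => Prod.ext rfl (by simp only [quandle]; ring)

theorem IsColoring.affine (h : A.IsColoring w o c) (x y : K) :
    A.IsColoring w o (fun k j => x * c k j + y) :=
  SymmetricQuandle.IsColoring.map (f := fun u : B × K => (u.1, x * u.2 + y)) h (fun _ => rfl)
    fun _ _ => by ext <;> simp only [quandle]; ring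

theorem IsColoring.beside_const (hw : Fits m w n) (h : A.IsColoring w o c) {u : ℕ → ℕ → B}
    (hu : A.directions.IsColoring w u)
    (huo : ∀ k ≤ w.length, ∀ j < lineWidth m w k, u k j = o k j) (x : K) :
    A.IsColoring w u (fun k => beside (lineWidth m w k) (c k) fun _ => x) := by
  refine (SymmetricQuandle.IsColoring.beside_right hw h fun e => (u 0 (m + e), x)).congr
    fun k hk => funext fun j => ?_
  rcases lt_or_ge j (lineWidth m w k) with hj | hj
  · simp only [beside_of_lt _ _ hj, huo k hk j hj]
  · obtain ⟨e, rfl⟩ := Nat.exists_eq_add_of_le hj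
    simp only [beside_add, hu.apply_lineWidth_add hw hk]

/-- Whatever the directions, there is an Alexander coloring with at least two different labels. -/
def Flexible (A : WeightedInvolution B K) (D : Tangle m n) : Prop :=
  ∀ o, A.directions.IsColoring D.word o → ∃ c, A.IsColoring D.word o c ∧ (D.labels c).Nontrivial

theorem labels_subset_singleton_of_rigid {D : Tangle m n} (hD : D.word = v ++ a ++ w)
    (ha : A.quandle.Rigid a) (hc : A.IsColoring D.word o c) {x : K}
    (below : ∀ k ≤ v.length, ∀ j < lineWidth m D.word k, c k j = x)
    (above : ∀ k ≤ w.length, ∀ j < lineWidth m D.word (v.length + a.length + k),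
      c (v.length + a.length + k) j = x) :
    D.labels c ⊆ {x} := by
  have hlen : D.word.length = v.length + a.length + w.length := by simp [hD, add_assoc]
  have hconst := (isColoring_const hc.directions x).beside_right D.fits
    fun e => (o 0 (m + e), c 0 (m + e))
  have hagree : ∀ k ≤ D.word.length, (∀ j < lineWidth m D.word k, c k j = x) →
      (fun j => (o k j, c k j)) = beside (lineWidth m D.word k) (fun j => (o k j, x))
        fun e => (o 0 (m + e), c 0 (m + e)) := by
    intro k hk hx
    funext j
    rcases lt_or_ge j (lineWidth m D.word k) with hj | hj
    · rw [beside_of_lt _ _ hj, hx j hj]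
    · obtain ⟨e, rfl⟩ := Nat.exists_eq_add_of_le hj
      rw [beside_add]
      exact SymmetricQuandle.IsColoring.apply_lineWidth_add D.fits hc hk e
  have heq := ha.eq_of_isColoring (hD ▸ hc) (hD ▸ hconst)
    (fun k hk => hagree k (by omega) (below k hk))
    fun k hk => hagree _ (by omega) (above k hk)
  intro y hy
  obtain ⟨k, hk, j, hj, rfl⟩ := Tangle.mem_labels.1 hy
  have hkj := congrFun (heq k (hD ▸ hk)) j
  rw [beside_of_lt _ _ hj] at hkj
  exact congrArg Prod.snd hkj

theorem Flexible.replace {D E : Tangle m n} {b : List Slice} (hQ : A.quandle.Interchangeable a b)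
    (hdir : A.directions.Interchangeable a b) (hD : D.word = v ++ a ++ w)
    (hE : E.word = v ++ b ++ w) (h : A.Flexible D) : A.Flexible E := by
  intro o ho
  obtain ⟨o', ho', hlow, hhigh⟩ := (hE ▸ ho).replace hdir.symm
  obtain ⟨c, hc, hnontrivial⟩ := h o' (hD ▸ ho')
  obtain ⟨e, he, helow, hehigh⟩ := SymmetricQuandle.IsColoring.replace hQ (hD ▸ hc)
  have hdirections : ∀ k ≤ E.word.length, o k = fun j => (e k j).1 := by
    rw [hE]
    refine hdir.rigid_right.eq_of_isColoring (hE ▸ ho)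
      (IsColoring.directions (c := fun k j => (e k j).2) he) (fun k hk => ?_) fun k _ => ?_
    · rw [helow k hk, hlow k hk]
    · rw [hehigh k, hhigh k]
  refine ⟨fun k j => (e k j).2, (hE ▸ he).congr fun k hk => by rw [hdirections k hk], ?_⟩
  by_contra hsub
  rw [Set.not_nontrivial_iff] at hsub
  obtain ⟨x, hx⟩ : ∃ x, E.labels (fun k j => (e k j).2) ⊆ {x} := by
    rcases hsub.eq_empty_or_singleton with h | ⟨x, h⟩
    · exact ⟨0, by simp [h]⟩
    · exact ⟨x, h.subset⟩
  have hlabel : ∀ k ≤ E.word.length, ∀ j < lineWidth m E.word k, (e k j).2 = x :=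
    fun k hk j hj => hx (Tangle.mem_labels.2 ⟨k, hk, j, hj, rfl⟩)
  have hlen : E.word.length = v.length + b.length + w.length := by simp [hE, add_assoc]
  obtain ⟨hwidth, hwidth'⟩ := Tangle.lineWidth_replace hD hE
  refine hnontrivial.not_subset_singleton (x := x) (labels_subset_singleton_of_rigid hD
    hQ.rigid_left hc (fun k hk j hj => ?_) fun k hk j hj => ?_)
  · rw [← hlabel k (by omega) j (hwidth k hk ▸ hj), helow k hk]
  · rw [← hlabel _ (by omega) j (hwidth' k ▸ hj), hehigh k]

theorem flexible_iff_of_isotopic {D E : Tangle m n} (h : D.Isotopic E) :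
    A.Flexible D ↔ A.Flexible E := by
  induction h with
  | rel D E h =>
    obtain ⟨v, w, a, b, hab, hD, hE⟩ := h
    have hQ := A.quandle.interchangeable_of_move hab
    have hdir := A.directions.interchangeable_of_move hab
    exact ⟨.replace hQ hdir hD hE, .replace hQ.symm hdir.symm hE hD⟩
  | refl D => rfl
  | symm D E _ ih => exact ih.symm
  | trans D E F _ _ ih ih' => exact ih.trans ih'

theorem flexible_stack {L L' : LinkDiagram} (hL : L.word ≠ []) (hL' : L'.word ≠ []) :
    A.Flexible (L.stack L') := by
  intro o ho
  obtain ⟨ho₁, ho₂⟩ := A.directions.isColoring_append.1 ho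
  let c k j := if k ≤ L.word.length ∧ j < lineWidth 0 L.word k then (1 : K) else 0
  have hc₁ : A.IsColoring L.word o c :=
    ((isColoring_const ho₁ 1).beside_const L.fits ho₁ (fun _ _ _ _ => rfl) 0).congr
      fun k hk => by simp [c, hk, beside]
  have hc₂ : ∀ k, c (L.word.length + k) = 0 := by
    rintro (_ | k) <;> funext j <;> simp [c, L.fits.lineWidth_length]
  refine ⟨c, A.quandle.isColoring_append.2 ⟨hc₁, ?_⟩, 1, ?_, 0, ?_, one_ne_zero⟩
  · simp only [hc₂]
    exact isColoring_const ho₂ 0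
  · have hlen := List.length_pos_of_ne_nil hL
    have hpos := L.fits.lineWidth_one_pos hL
    refine Tangle.mem_labels.2 ⟨1, by simp only [Tangle.stack, List.length_append]; omega, 0, ?_,
      if_pos ⟨hlen, hpos⟩⟩
    rwa [Tangle.stack, lineWidth_append_left _ _ hlen]
  · have hlen := List.length_pos_of_ne_nil hL'
    refine Tangle.mem_labels.2 ⟨L.word.length + 1,
      by simp only [Tangle.stack, List.length_append]; omega, 0, ?_, congrFun (hc₂ 1) 0⟩
    rw [Tangle.stack, lineWidth_append_right, L.fits.lineWidth_length]
    exact L'.fits.lineWidth_one_pos hL'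

theorem flexible_of_isSplit {L : LinkDiagram} (hL : L.IsSplit) : A.Flexible L := by
  obtain ⟨L₁, L₂, h₁, h₂, h⟩ := hL
  exact (flexible_iff_of_isotopic h).2 (flexible_stack h₁ h₂)

end WeightedInvolution

/-! ### Numerator closures and sums -/

namespace SymmetricQuandle

variable {X : Type*} {Q : SymmetricQuandle X} {w : List Slice} {c d e : ℕ → ℕ → X} {i : ℕ}
  {S T : Tangle 2 2}

theorem isColoring_cup_cap :
    Q.IsColoring ([Slice.cup i] ++ w ++ [Slice.cap i]) c ↔
      (∃ x, c 1 = Q.cupped i x (c 0)) ∧ Q.IsColoring w (fun k => c (1 + k)) ∧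
        ∃ x, c (1 + w.length) = Q.cupped i x (c (w.length + 2)) := by
  simp only [isColoring_append, isColoring_cons, isColoring_nil, across_cup, across_cap, and_true,
    List.length_append, List.length_singleton, add_zero, and_assoc, add_comm 1 w.length]

theorem IsColoring.exists_cup_cap {s t : ℕ → X} {x y : X} (h : Q.IsColoring w c)
    (hs : c 0 = Q.cupped i x s) (ht : c w.length = Q.cupped i y t) :
    ∃ d, Q.IsColoring ([Slice.cup i] ++ w ++ [Slice.cap i]) d ∧ d 0 = s ∧
      (∀ k ≤ w.length, d (1 + k) = c k) ∧ d (w.length + 2) = t := by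
  let d k := if k = 0 then s else if k ≤ 1 + w.length then c (k - 1) else t
  have hd : ∀ k ≤ w.length, d (1 + k) = c k := fun k hk => by simp [d, hk]
  have htop : d (w.length + 2) = t := by simp [d, show ¬ w.length + 2 ≤ 1 + w.length by omega]
  refine ⟨d, isColoring_cup_cap.2 ⟨⟨x, ?_⟩, h.congr hd, y, ?_⟩, rfl, hd, htop⟩
  · exact (hd 0 (Nat.zero_le _)).trans hs
  · rw [hd _ le_rfl, ht, htop]

theorem exists_eq_cupped_zero {s : ℕ → X} : (∃ x t, s = Q.cupped 0 x t) ↔ s 1 = Q.star (s 0) := by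
  constructor
  · rintro ⟨x, t, rfl⟩
    simp [cupped]
  · intro h
    refine ⟨s 0, fun j => s (j + 2), funext fun j => ?_⟩
    rcases j with _ | _ | j <;> simp [cupped, h]

theorem IsColoring.exists_numerator (h : Q.IsColoring T.word c) (hbot : c 0 1 = Q.star (c 0 0))
    (htop : c T.word.length 1 = Q.star (c T.word.length 0)) :
    ∃ d, Q.IsColoring T.numerator.word d ∧ ∀ k ≤ T.word.length, d (1 + k) = c k := by
  obtain ⟨x, s, hs⟩ := exists_eq_cupped_zero.2 hbot
  obtain ⟨y, t, ht⟩ := exists_eq_cupped_zero.2 htop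
  obtain ⟨d, hd, -, hdc, -⟩ := h.exists_cup_cap hs ht
  exact ⟨d, hd, hdc⟩

theorem IsColoring.of_numerator (h : Q.IsColoring T.numerator.word c) :
    Q.IsColoring T.word (fun k => c (1 + k)) ∧ c 1 1 = Q.star (c 1 0) ∧
      c (1 + T.word.length) 1 = Q.star (c (1 + T.word.length) 0) := by
  obtain ⟨⟨x, hx⟩, hT, ⟨y, hy⟩⟩ := isColoring_cup_cap.1 h
  exact ⟨hT, exists_eq_cupped_zero.1 ⟨x, _, hx⟩, exists_eq_cupped_zero.1 ⟨y, _, hy⟩⟩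

end SymmetricQuandle

namespace Tangle

variable {X : Type*} {S T : Tangle 2 2} {c e : ℕ → ℕ → X} {k j : ℕ}

theorem length_sum : (S.sum T).word.length = S.word.length + T.word.length + 2 := by
  simp only [sum, List.length_append, List.length_map, List.length_singleton]
  omega

theorem lineWidth_cup_cap {m i : ℕ} {w : List Slice} (hk : k ≤ w.length) :
    lineWidth m ([Slice.cup i] ++ w ++ [Slice.cap i]) (1 + k) = lineWidth (m + 2) w k := by
  rw [lineWidth_append_left _ _ (by simpa [add_comm] using hk)]
  exact lineWidth_append_right m [Slice.cup i] w k

theorem lineWidth_numerator (hk : k ≤ T.word.length) :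
    lineWidth 0 T.numerator.word (1 + k) = lineWidth 2 T.word k := lineWidth_cup_cap hk

theorem lineWidth_sum_left (hk : k ≤ S.word.length) :
    lineWidth 2 (S.sum T).word (1 + k) = lineWidth 2 S.word k + 2 := by
  rw [← S.fits.lineWidth_right, sum, lineWidth_cup_cap (by rw [List.length_append]; omega),
    lineWidth_append_left _ _ hk]

theorem lineWidth_sum_right (hk : k ≤ T.word.length) :
    lineWidth 2 (S.sum T).word (1 + S.word.length + k) = 2 + lineWidth 2 T.word k := by
  rw [add_assoc, ← T.fits.lineWidth_left, sum, lineWidth_cup_cap (by simpa using hk),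
    lineWidth_append_right, (S.fits.right 2).lineWidth_length]

theorem mem_labels_numerator {x : X} :
    x ∈ T.numerator.labels c ↔
      ∃ k ≤ T.word.length, ∃ j < lineWidth 2 T.word k, c (1 + k) j = x := by
  have hlen : T.numerator.word.length = T.word.length + 2 := by simp [numerator]
  rw [mem_labels, hlen]
  constructor
  · rintro ⟨k, hk, j, hj, rfl⟩
    rcases k with _ | k
    · simp [lineWidth_zero] at hj
    · rcases hk.eq_or_lt with hk | hk
      · rw [hk, ← hlen, T.numerator.fits.lineWidth_length] at hj
        omega
      · rw [add_comm, lineWidth_numerator (by omega)] at hj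
        exact ⟨k, by omega, j, hj, by rw [add_comm]⟩
  · rintro ⟨k, hk, j, hj, rfl⟩
    exact ⟨1 + k, by omega, j, lineWidth_numerator hk ▸ hj, rfl⟩

theorem mem_labels_numerator_sum_left (hk : k ≤ S.word.length) (hj : j < lineWidth 2 S.word k) :
    e (2 + k) j ∈ (S.sum T).numerator.labels e := by
  refine mem_labels_numerator.2 ⟨1 + k, by rw [length_sum]; omega, j, ?_, by rw [← add_assoc]⟩
  rw [lineWidth_sum_left hk]
  omega

theorem mem_labels_numerator_sum_right (hk : k ≤ T.word.length) (hj : j < lineWidth 2 T.word k) :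
    e (2 + S.word.length + k) (2 + j) ∈ (S.sum T).numerator.labels e := by
  refine mem_labels_numerator.2
    ⟨1 + S.word.length + k, by rw [length_sum]; omega, 2 + j, ?_, by rw [← add_assoc, ← add_assoc]⟩
  rw [lineWidth_sum_right hk]
  omega

end Tangle

namespace SymmetricQuandle

variable {X : Type*} {Q : SymmetricQuandle X} {c d e : ℕ → ℕ → X} {S T : Tangle 2 2}

theorem beside_two_eq_cupped_one {s t : ℕ → X} (hs : s 1 = Q.star (s 0)) (h : s 0 = t 0) :
    beside 2 s t = Q.cupped 1 (s 1) t := by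
  funext j
  rcases j with _ | _ | _ | j <;> simp [beside, cupped, hs, h, Q.star_star]

theorem exists_isColoring_numerator_sum (hc : Q.IsColoring S.numerator.word c)
    (hd : Q.IsColoring T.numerator.word d) (hbot : c 1 0 = d 1 0)
    (htop : c (1 + S.word.length) 0 = d (1 + T.word.length) 0) :
    ∃ e, Q.IsColoring (S.sum T).numerator.word e ∧ e 1 = d 1 ∧
      S.numerator.labels c ⊆ (S.sum T).numerator.labels e ∧
      T.numerator.labels d ⊆ (S.sum T).numerator.labels e := by
  obtain ⟨⟨x, hx⟩, hT, ⟨y, hy⟩⟩ := isColoring_cup_cap.1 hd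
  obtain ⟨hS, hbotS, htopS⟩ := hc.of_numerator
  obtain ⟨e₁, he₁, hleft, hright⟩ := hS.exists_beside S.fits hT
  have hlen : (S.word ++ T.word.map (Slice.shift 2)).length = S.word.length + T.word.length := by
    simp
  obtain ⟨e₂, he₂, hbot₂, hmid₂, htop₂⟩ := he₁.exists_cup_cap (i := 1)
    ((hleft 0 (Nat.zero_le _)).trans (beside_two_eq_cupped_one hbotS hbot))
    ((hlen ▸ hright _).trans (beside_two_eq_cupped_one htopS htop))
  change Q.IsColoring (S.sum T).word e₂ at he₂
  rw [hlen] at hmid₂ htop₂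
  obtain ⟨e, he, -, hmid, -⟩ := he₂.exists_cup_cap (i := 0) (hbot₂.trans hx)
    (by rw [Tangle.length_sum, htop₂, hy])
  rw [Tangle.length_sum] at hmid
  refine ⟨e, he, (hmid 0 (Nat.zero_le _)).trans hbot₂, ?_, ?_⟩ <;> rintro _ hx <;>
    obtain ⟨k, hk, j, hj, rfl⟩ := Tangle.mem_labels_numerator.1 hx
  · have heq : e (2 + k) j = c (1 + k) j := by
      rw [show 2 + k = 1 + (1 + k) by omega, hmid _ (by omega), hmid₂ k (by omega), hleft k hk,
        beside_of_lt _ _ hj]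
    exact heq ▸ Tangle.mem_labels_numerator_sum_left hk hj
  · have heq : e (2 + S.word.length + k) (2 + j) = d (1 + k) j := by
      rw [show 2 + S.word.length + k = 1 + (1 + (S.word.length + k)) by omega, hmid _ (by omega),
        hmid₂ _ (by omega), hright k, beside_add]
    exact heq ▸ Tangle.mem_labels_numerator_sum_right hk hj

theorem cupped_one_of_star {s t : ℕ → X} {x : X} (hs : s 1 = Q.star (s 0))
    (ht : t = Q.cupped 1 x s) : t 0 = s 0 ∧ t 2 = Q.star (t 1) ∧ t 3 = Q.star (t 0) := by
  subst ht
  simp [cupped, hs]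

theorem IsColoring.exists_of_numerator_sum (h : Q.IsColoring (S.sum T).numerator.word e) :
    ∃ c d, Q.IsColoring S.word c ∧ Q.IsColoring T.word d ∧ c 0 0 = e 1 0 ∧
      (d 0 0 = Q.star (c 0 1) ∧ d 0 1 = Q.star (c 0 0)) ∧
      (d T.word.length 0 = Q.star (c S.word.length 1) ∧
        d T.word.length 1 = Q.star (c S.word.length 0)) := by
  obtain ⟨hsum, hbot, htop⟩ := h.of_numerator
  obtain ⟨⟨x, hx⟩, hmid, ⟨y, hy⟩⟩ := isColoring_cup_cap.1 hsum
  obtain ⟨hS, hT⟩ := Q.isColoring_append.1 hmid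
  have hright := hS.apply_lineWidth_add S.fits le_rfl
  have hleft₀ := hT.apply_of_lt le_rfl Nat.zero_lt_two
  have hleft₁ := hT.apply_of_lt le_rfl Nat.one_lt_two
  rw [S.fits.lineWidth_length] at hright
  simp only [Tangle.length_sum, List.length_append, List.length_map, add_zero] at *
  obtain ⟨hbot₀, hbot₂, hbot₃⟩ := cupped_one_of_star hbot hx
  obtain ⟨-, htop₂, htop₃⟩ := cupped_one_of_star htop hy
  exact ⟨_, _, hS, hT.of_shift, hbot₀, ⟨(hright 0).trans hbot₂, (hright 1).trans hbot₃⟩,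
    htop₂.trans (by rw [hleft₁]), htop₃.trans (by rw [hleft₀])⟩

theorem labels_comp {Y : Type*} {m n : ℕ} (f : X → Y) (D : Tangle m n) (c : ℕ → ℕ → X) :
    D.labels (fun k j => f (c k j)) = f '' D.labels c := by
  simp only [Tangle.labels, Set.image_image]

end SymmetricQuandle

/-! ### Knots and orientations -/

/-- Colorings by this quandle are constant along the components of a link. -/
def unoriented (X : Type*) : SymmetricQuandle X := .ofInvolution id fun _ => rfl

/-- Colorings by this quandle are the orientations of a diagram; the label `true` means that the
strand is directed upwards. -/
def orientations : SymmetricQuandle Bool := .ofInvolution not Bool.not_not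

namespace Tangle

variable {X : Type*} {m n : ℕ} {D : Tangle m n} {L : LinkDiagram} {a b : ℕ × ℕ} {c : ℕ → ℕ → X}

theorem Adjacent.apply_eq (hc : (unoriented X).IsColoring D.word c) (h : D.Adjacent a b) :
    c a.1 a.2 = c b.1 b.2 := by
  rcases h with (⟨k, j, p, hp, hj⟩ | ⟨k, e, p, hp⟩) | (⟨k, i, hp⟩ | ⟨k, i, hp⟩) |
    (⟨k, i, hp⟩ | ⟨k, i, hp⟩) | (⟨k, i, hp⟩ | ⟨k, i, hp⟩)
  · exact ((hc k p hp).1 j hj).symm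
  · exact ((hc k p hp).2.1 e).symm
  · exact (hc k _ hp).2.2.2.symm
  · exact (hc k _ hp).2.2.1.symm
  · exact (hc k _ hp).2.2.1.symm
  · exact (hc k _ hp).2.2.2.symm
  · exact (hc k _ hp).2.2.symm
  · exact (hc k _ hp).2.2.symm

theorem IsKnot.labels_subsingleton (hL : L.IsKnot) (hc : (unoriented X).IsColoring L.word c) :
    (L.labels c).Subsingleton := by
  rintro _ ⟨a, ha, rfl⟩ _ ⟨b, hb, rfl⟩
  have hab := hL.2 a ha b hb
  clear ha hb
  induction hab with
  | rel a b h => exact h.apply_eq hc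
  | refl a => rfl
  | symm a b _ ih => exact ih.symm
  | trans a b c _ _ ih ih' => exact ih.trans ih'

theorem IsKnot.orientation_unique (hL : L.IsKnot) {o o' : ℕ → ℕ → Bool}
    (ho : orientations.IsColoring L.word o) (ho' : orientations.IsColoring L.word o')
    (ha : a ∈ L.points) (h : o a.1 a.2 = o' a.1 a.2) (hb : b ∈ L.points) :
    o b.1 b.2 = o' b.1 b.2 := by
  have hagree : (unoriented Bool).IsColoring L.word fun k j => o k j == o' k j :=
    ho.map₂ ho' (by decide) fun _ _ _ _ => rfl
  have hab := hL.labels_subsingleton hagree ⟨a, ha, rfl⟩ ⟨b, hb, rfl⟩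
  simpa [h] using hab

theorem IsOrientation.isColoring {up : ℕ × ℕ → Bool} (h : D.IsOrientation up) :
    orientations.IsColoring D.word fun k j => up (k, j) := by
  rintro k ⟨A, i⟩ hp
  refine ⟨fun j hj => (h.1 _ _ (.inl (.left k j _ hp hj))).symm,
    fun e => (h.1 _ _ (.inl (.right k e _ hp))).symm, ?_⟩
  rcases A with _ | _ | (_ | _)
  · exact Bool.eq_not.2 (h.2 _ _ (.cup k i hp)).symm
  · exact Bool.eq_not.2 (h.2 _ _ (.cap k i hp)).symm
  · exact ⟨(h.1 _ _ (.inr (.inl (.falling k i hp)))).symm,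
      (h.1 _ _ (.inr (.inr (.rising k i hp)))).symm⟩
  · exact ⟨(h.1 _ _ (.inr (.inr (.falling k i hp)))).symm,
      (h.1 _ _ (.inr (.inl (.rising k i hp)))).symm⟩

end Tangle

theorem SymmetricQuandle.isColoring_unoriented_const {X : Type*} (w : List Slice) (x : X) :
    (unoriented X).IsColoring w fun _ _ => x := by
  rintro k ⟨_ | _ | (_ | _), i⟩ -
  exacts [⟨fun _ _ => rfl, fun _ => rfl, rfl⟩, ⟨fun _ _ => rfl, fun _ => rfl, rfl⟩,
    ⟨fun _ _ => rfl, fun _ => rfl, rfl, rfl⟩, ⟨fun _ _ => rfl, fun _ => rfl, rfl, rfl⟩]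

/-! ### Conservation of flow -/

namespace SymmetricQuandle

variable {G : Type*} [AddCommGroup G]

/-- Colorings by this quandle are flows through a diagram, measured upwards. -/
def flows (G : Type*) [AddCommGroup G] : SymmetricQuandle G := .ofInvolution Neg.neg neg_neg

theorem Across.sum_eq {p : Slice} {s t : ℕ → G} (h : (flows G).Across p s t) {m : ℕ}
    (hp : p.pos + p.kind.ins ≤ m) :
    ∑ j ∈ Finset.range (p.after m), t j = ∑ j ∈ Finset.range m, s j := by
  obtain ⟨r, rfl⟩ := Nat.exists_eq_add_of_le hp
  obtain ⟨left, right, vertex⟩ := h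
  rw [show p.after (p.pos + p.kind.ins + r) = p.pos + p.kind.outs + r by
    simp only [Slice.after]; omega]
  simp only [Finset.sum_range_add, right]
  congr 2
  · exact Finset.sum_congr rfl fun j hj => left j (Finset.mem_range.1 hj)
  · rcases p with ⟨_ | _ | (_ | _), i⟩ <;>
      simp_all [Vertex, flows, ofInvolution, SliceKind.ins, SliceKind.outs, Finset.sum_range_succ,
        add_comm]

theorem IsColoring.sum_eq {m n : ℕ} {w : List Slice} (hw : Fits m w n) {c : ℕ → ℕ → G}
    (hc : (flows G).IsColoring w c) :
    ∑ j ∈ Finset.range n, c w.length j = ∑ j ∈ Finset.range m, c 0 j := by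
  induction w generalizing m c with
  | nil => rw [show m = n from hw, List.length_nil]
  | cons p w ih =>
    obtain ⟨hp, hw'⟩ := (flows G).isColoring_cons.1 hc
    exact (ih hw.2 hw').trans (hp.sum_eq hw.1)

theorem IsColoring.flow {w : List Slice} {o : ℕ → ℕ → Bool} {g : ℕ → ℕ → G}
    (ho : orientations.IsColoring w o) (hg : (unoriented G).IsColoring w g) :
    (flows G).IsColoring w fun k j => bif o k j then g k j else -g k j := by
  refine ho.map₂ (f := fun u x => bif u then x else -x) hg ?_ fun _ _ _ _ => rfl
  rintro (_ | _) x
  · exact (neg_neg x).symm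
  · rfl

/-- Both the flow `1` and the flow `g` along `o` are conserved, and `g` distinguishes the two
pairs of ends. -/
theorem IsColoring.orientation_ends_reversed {S : Tangle 2 2} {o : ℕ → ℕ → Bool}
    {g : ℕ → ℕ → ℚ} (ho : orientations.IsColoring S.word o)
    (hg : (unoriented ℚ).IsColoring S.numerator.word g)
    (hne : g 1 0 ≠ g (1 + S.word.length) 0) :
    o 0 1 = orientations.star (o 0 0) ∧
      o S.word.length 1 = orientations.star (o S.word.length 0) := by
  obtain ⟨hgS, hbot, htop⟩ := hg.of_numerator
  have hflow := (ho.flow hgS).sum_eq S.fits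
  have hnumber := (ho.flow (isColoring_unoriented_const S.word (1 : ℚ))).sum_eq S.fits
  simp only [unoriented, ofInvolution, id] at hbot htop
  simp only [Finset.sum_range_succ, Finset.sum_range_zero, zero_add, add_zero, hbot, htop]
    at hflow hnumber
  generalize o 0 0 = b₀, o 0 1 = b₁, o S.word.length 0 = t₀, o S.word.length 1 = t₁ at *
  cases b₀ <;> cases b₁ <;> cases t₀ <;> cases t₁ <;>
    first
    | exact ⟨rfl, rfl⟩
    | exact absurd (by simp only [cond_true, cond_false] at hflow hnumber; linarith) hne

end SymmetricQuandle

/-! ### Gluing of nonconstant colorings -/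

namespace WeightedInvolution

section

variable {B K : Type*} [Field K] {A : WeightedInvolution B K} {S T : Tangle 2 2}
  {o o' : ℕ → ℕ → B} {c c' : ℕ → ℕ → K}

theorem exists_isColoring_numerator_sum (hc : A.IsColoring S.numerator.word o c)
    (hc' : A.IsColoring T.numerator.word o' c') (hbot : o 1 0 = o' 1 0)
    (htop : o (1 + S.word.length) 0 = o' (1 + T.word.length) 0) (hbot' : c 1 0 = c' 1 0)
    (htop' : c (1 + S.word.length) 0 = c' (1 + T.word.length) 0) :
    ∃ u d, A.IsColoring (S.sum T).numerator.word u d ∧ u 1 = o' 1 ∧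
      S.numerator.labels c ⊆ (S.sum T).numerator.labels d ∧
      T.numerator.labels c' ⊆ (S.sum T).numerator.labels d := by
  obtain ⟨e, he, hone, hS, hT⟩ := SymmetricQuandle.exists_isColoring_numerator_sum hc hc'
    (Prod.ext hbot hbot') (Prod.ext htop htop')
  refine ⟨fun k j => (e k j).1, fun k j => (e k j).2, he, by simp only [hone], ?_, ?_⟩
  · simpa only [← SymmetricQuandle.labels_comp] using Set.image_mono (f := Prod.snd) hS
  · simpa only [← SymmetricQuandle.labels_comp] using Set.image_mono (f := Prod.snd) hT

theorem exists_isColoring_numerator_sum_of_nontrivial (hc : A.IsColoring S.numerator.word o c)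
    (hc' : A.IsColoring T.numerator.word o' c') (hbot : o 1 0 = o' 1 0)
    (htop : o (1 + S.word.length) 0 = o' (1 + T.word.length) 0)
    (hS : (S.numerator.labels c).Nontrivial) (hT : (T.numerator.labels c').Nontrivial) :
    ∃ u d, A.IsColoring (S.sum T).numerator.word u d ∧ u 1 = o' 1 ∧
      ((S.sum T).numerator.labels d).Nontrivial := by
  by_cases heq : c 1 0 = c (1 + S.word.length) 0
  · obtain ⟨u, d, hd, hone, hsub, -⟩ := exists_isColoring_numerator_sum hc
      (isColoring_const hc'.directions (c 1 0)) hbot htop rfl heq.symm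
    exact ⟨u, d, hd, hone, hS.mono hsub⟩
  · have hne : c (1 + S.word.length) 0 - c 1 0 ≠ 0 := sub_ne_zero.2 (Ne.symm heq)
    let x := (c' (1 + T.word.length) 0 - c' 1 0) / (c (1 + S.word.length) 0 - c 1 0)
    obtain ⟨u, d, hd, hone, -, hsub⟩ := exists_isColoring_numerator_sum
      (hc.affine x (c' 1 0 - x * c 1 0)) hc' hbot htop (add_sub_cancel _ _)
      (by linear_combination div_mul_cancel₀ (c' (1 + T.word.length) 0 - c' 1 0) hne)
    exact ⟨u, d, hd, hone, hT.mono hsub⟩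

end

/-- Strands without directions; labels do not change at the crossings. -/
def undirected (K : Type*) [Field K] : WeightedInvolution Unit K where
  reverse := id
  weight _ := 1
  reverse_reverse _ := rfl
  weight_reverse _ := inv_one.symm

/-- Oriented strands; colorings correspond to the Alexander module at `t = z`.  The direction `true`
is upwards, as in `orientations`. -/
def oriented {K : Type*} [Field K] (z : Kˣ) : WeightedInvolution Bool K where
  reverse := not
  weight u := bif u then z else z⁻¹
  reverse_reverse := Bool.not_not
  weight_reverse u := by cases u <;> simp only [Bool.not_true, Bool.not_false, cond_true,
    cond_false, inv_inv]

end WeightedInvolution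

namespace Tangle

open SymmetricQuandle WeightedInvolution

variable {S T : Tangle 2 2} {K : Type*} [Field K]

theorem exists_unoriented_ends_ne (K : Type*) [Field K] (hST : (S.sum T).numerator.IsKnot)
    (hS : S.numerator.IsSplit) :
    ∃ g, (unoriented K).IsColoring S.numerator.word g ∧ g 1 0 ≠ g (1 + S.word.length) 0 := by
  obtain ⟨g, hg, hnontrivial⟩ := flexible_of_isSplit (A := undirected K) hS (fun _ _ => ())
    (isColoring_unoriented_const _ ())
  have hg' : (unoriented K).IsColoring S.numerator.word g :=
    SymmetricQuandle.IsColoring.map (f := Prod.snd) hg (fun _ => rfl)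
      fun _ _ => by simp [quandle, undirected, unoriented, ofInvolution]
  refine ⟨g, hg', fun heq => ?_⟩
  obtain ⟨e, he, -, hsub, -⟩ := SymmetricQuandle.exists_isColoring_numerator_sum hg'
    (isColoring_unoriented_const T.numerator.word (g 1 0)) rfl heq.symm
  exact (hnontrivial.mono hsub).not_subsingleton (hST.labels_subsingleton he)

theorem mem_points_numerator {k j : ℕ} (hk : k ≤ T.word.length) (hj : j < lineWidth 2 T.word k) :
    (1 + k, j) ∈ T.numerator.points :=
  mem_points.2 ⟨by simp only [numerator, List.length_append, List.length_singleton]; omega,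
     (lineWidth_numerator hk).symm ▸ hj⟩

theorem IsKnot.exists_orientation_left (hST : (S.sum T).numerator.IsKnot)
    (hT : T.numerator.IsKnot) (hS : S.numerator.IsSplit) {u o : ℕ → ℕ → Bool}
    (hu : orientations.IsColoring (S.sum T).numerator.word u)
    (ho : orientations.IsColoring T.numerator.word o) (hbot : u 1 0 = o 1 0) :
    ∃ o', orientations.IsColoring S.numerator.word o' ∧ o' 1 0 = o 1 0 ∧
      o' (1 + S.word.length) 0 = o (1 + T.word.length) 0 := by
  obtain ⟨uS, uT, huS, huT, hleft, ⟨hbot₀, hbot₁⟩, htop₀, htop₁⟩ := hu.exists_of_numerator_sum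
  obtain ⟨g, hg, hne⟩ := exists_unoriented_ends_ne ℚ hST hS
  obtain ⟨hbotS, htopS⟩ := huS.orientation_ends_reversed hg hne
  rw [hbotS, star_star] at hbot₀
  rw [htopS, star_star] at htop₀
  obtain ⟨oS, hoS, hoS'⟩ := huS.exists_numerator hbotS htopS
  obtain ⟨oT, hoT, hoT'⟩ := huT.exists_numerator (by rw [hbot₀, hbot₁]) (by rw [htop₀, htop₁])
  have hbotT : oT 1 0 = o 1 0 := by rw [← hbot, ← hleft, ← hbot₀, ← hoT' 0 (Nat.zero_le _)]
  have htopT := hT.orientation_unique hoT ho (mem_points_numerator (Nat.zero_le _) two_pos) hbotT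
    (mem_points_numerator le_rfl (T.fits.lineWidth_length.symm ▸ two_pos))
  refine ⟨oS, hoS, ?_, ?_⟩
  · rw [← hbot, ← hleft, ← hoS' 0 (Nat.zero_le _)]
  · rw [← htopT, hoS' _ le_rfl, hoT' _ le_rfl, htop₀]

/-- The diagram has an Alexander coloring at `t = z` which is not constant; as in
`IsAlexanderPolynomial`, its first minimum is run through from left to right. -/
def IsColorable (L : LinkDiagram) (z : Kˣ) : Prop :=
  ∃ o c, (oriented z).IsColoring L.word o c ∧ o 1 0 = false ∧ (L.labels c).Nontrivial

theorem IsColorable.numerator_sum {z : Kˣ} (hST : (S.sum T).numerator.IsKnot)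
    (hT : T.numerator.IsKnot) (hS : S.numerator.IsSplit) {u : ℕ → ℕ → Bool}
    (hu : orientations.IsColoring (S.sum T).numerator.word u) (hu' : u 1 0 = false)
    (h : T.numerator.IsColorable z) : (S.sum T).numerator.IsColorable z := by
  obtain ⟨o, c, hc, ho, hnontrivial⟩ := h
  obtain ⟨o', ho', hbot, htop⟩ :=
    hST.exists_orientation_left hT hS hu hc.directions (hu'.trans ho.symm)
  obtain ⟨s, hs, hs'⟩ := flexible_of_isSplit (A := oriented z) hS o' ho'
  obtain ⟨e, d, hd, hone, hd'⟩ :=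
    exists_isColoring_numerator_sum_of_nontrivial hs hc hbot htop hs' hnontrivial
  exact ⟨e, d, hd, by rw [hone, ho], hd'⟩

end Tangle

/-! ### Roots of greatest common divisors -/

theorem isPrincipal_ker_aeval_int {K : Type*} [Field K] [CharZero K] (z : K) :
    (RingHom.ker (Polynomial.aeval (R := ℤ) z)).IsPrincipal := by
  rcases eq_or_ne (RingHom.ker (Polynomial.aeval (R := ℤ) z)) ⊥ with hbot | hbot
  · rw [hbot]
    infer_instance
  obtain ⟨g, hg, hprime⟩ := (RingHom.ker_isPrime _).exists_mem_prime_of_ne_bot hbot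
  rw [RingHom.mem_ker] at hg
  have hdegree : g.natDegree ≠ 0 := by
    intro h
    obtain ⟨a, rfl⟩ := Polynomial.natDegree_eq_zero.1 h
    refine hprime.ne_zero ?_
    simpa using hg
  have hprimitive := hprime.irreducible.isPrimitive hdegree
  have hroot (q : Polynomial ℤ) (hq : Polynomial.aeval z q = 0) :
      minpoly ℚ z ∣ q.map (Int.castRingHom ℚ) :=
    minpoly.dvd ℚ z ((Polynomial.aeval_map_algebraMap ℚ z q).trans hq)
  have hirreducible :=
    (Polynomial.IsPrimitive.Int.irreducible_iff_irreducible_map_cast hprimitive).1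
      hprime.irreducible
  have hintegral : IsIntegral ℚ z := IsAlgebraic.isIntegral
    ⟨_, hirreducible.ne_zero, (Polynomial.aeval_map_algebraMap ℚ z g).trans hg⟩
  have hminpoly : g.map (Int.castRingHom ℚ) ∣ minpoly ℚ z :=
    (minpoly.irreducible hintegral).dvd_symm hirreducible (hroot g hg)
  refine ⟨g, le_antisymm (fun q hq => ?_) ((Ideal.span_singleton_le_iff_mem _).2 hg)⟩
  refine Ideal.mem_span_singleton.2 ?_
  rw [Polynomial.IsPrimitive.Int.dvd_iff_map_cast_dvd_map_cast _ _ hprimitive]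
  exact hminpoly.trans (hroot q hq)

/-- Evaluation of integral Laurent polynomials at `t = z`. -/
noncomputable abbrev evalAt {K : Type*} [Field K] (z : Kˣ) : ℤ[T;T⁻¹] →+* K :=
  LaurentPolynomial.eval₂ (Int.castRingHom K) z

theorem evalAt_eq_zero_iff_of_isGCD {K : Type*} [Field K] [CharZero K] (z : Kˣ)
    {s : Set ℤ[T;T⁻¹]} {Δ : ℤ[T;T⁻¹]} (hΔ : ∀ d, d ∣ Δ ↔ ∀ μ ∈ s, d ∣ μ) :
    evalAt z Δ = 0 ↔ ∀ μ ∈ s, evalAt z μ = 0 := by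
  refine ⟨fun h μ hμ => zero_dvd_iff.1 (h ▸ map_dvd (evalAt z) ((hΔ Δ).1 dvd_rfl μ hμ)),
    fun h => ?_⟩
  obtain ⟨g, hg⟩ := isPrincipal_ker_aeval_int (z : K)
  have hker (p : Polynomial ℤ) : evalAt z (Polynomial.toLaurent p) = 0 ↔ g ∣ p := by
    rw [← Ideal.mem_span_singleton, Ideal.span, ← hg, RingHom.mem_ker, evalAt,
      LaurentPolynomial.eval₂_toLaurent]
    rfl
  have hdvd : Polynomial.toLaurent g ∣ Δ := by
    refine (hΔ _).2 fun μ hμ => ?_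
    obtain ⟨n, p, hp⟩ := μ.exists_T_pow
    refine ((LaurentPolynomial.isUnit_T n).dvd_mul_right).1 (hp ▸ map_dvd _ ((hker p).1 ?_))
    rw [hp, map_mul, h μ hμ, zero_mul]
  exact zero_dvd_iff.1 ((hker g).2 dvd_rfl ▸ map_dvd (evalAt z) hdvd)

/-! ### Minors -/

section Minors

open Matrix

variable {ρ κ ι K : Type*} [Fintype κ] [Fintype ι] [Field K]

theorem forall_det_submatrix_eq_zero_iff [DecidableEq κ] (M : Matrix ρ κ K) :
    (∀ r : κ → ρ, (M.submatrix r id).det = 0) ↔ ∃ g ≠ 0, M *ᵥ g = 0 := by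
  constructor
  · intro h
    have hspan : Submodule.span K (Set.range M) < ⊤ := by
      refine lt_top_iff_ne_top.2 fun htop => ?_
      obtain ⟨B, hB, hspan, hindep⟩ := exists_linearIndependent K (Set.range M)
      let i : κ ≃ B := (Pi.basisFun K κ).indexEquiv
        (.mk hindep (by rw [Subtype.range_coe, hspan, htop]))
      choose r hr using fun b : B => hB b.2
      have hrows : LinearIndependent K (M.submatrix (r ∘ i) id).row := by
        rw [show (M.submatrix (r ∘ i) id).row = Subtype.val ∘ i from funext fun a => hr (i a)]
        exact hindep.comp i i.injective
      rw [linearIndependent_rows_iff_isUnit, isUnit_iff_isUnit_det, h] at hrows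
      exact not_isUnit_zero hrows
    obtain ⟨φ, hφ, hker⟩ := Submodule.exists_le_ker_of_lt_top _ hspan
    obtain ⟨g, rfl⟩ := (dotProductEquiv K κ).surjective φ
    refine ⟨g, fun h0 => hφ (by rw [h0, map_zero]), funext fun a => ?_⟩
    exact (dotProduct_comm _ _).trans (hker (Submodule.subset_span ⟨a, rfl⟩))
  · rintro ⟨g, hg, h⟩ r
    exact exists_mulVec_eq_zero_iff.1 ⟨g, hg, funext fun a => congrFun h (r a)⟩

theorem exists_nonconstant_mulVec_iff {M : Matrix ρ ι K} (hM : M *ᵥ 1 = 0) (e : Option κ ≃ ι) :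
    (∃ f, M *ᵥ f = 0 ∧ (Set.range f).Nontrivial) ↔
      ∃ g ≠ 0, M.submatrix id (fun b => e (some b)) *ᵥ g = 0 := by
  have hsum (f : ι → K) (a : ρ) :
      (M *ᵥ f) a = M a (e none) * f (e none) + ∑ b, M a (e (some b)) * f (e (some b)) := by
    rw [← Fintype.sum_option fun o => M a (e o) * f (e o), e.sum_comp fun p => M a p * f p]
    rfl
  constructor
  · rintro ⟨f, hf, hne⟩
    refine ⟨fun b => f (e (some b)) - f (e none), fun h => ?_, funext fun a => ?_⟩
    · refine hne.not_subset_singleton (x := f (e none)) (Set.range_subset_iff.2 fun p => ?_)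
      obtain ⟨_ | b, rfl⟩ := e.surjective p
      exacts [rfl, sub_eq_zero.1 (congrFun h b)]
    · have hzero : (M *ᵥ (f - f (e none) • 1)) a = 0 := by
        rw [mulVec_sub, mulVec_smul, hf, hM, smul_zero, sub_zero, Pi.zero_apply]
      rw [hsum] at hzero
      simpa using! hzero
  · rintro ⟨g, hg, h⟩
    obtain ⟨b, hb⟩ := Function.ne_iff.1 hg
    refine ⟨fun p => (e.symm p).elim 0 g, funext fun a => ?_, g b, ⟨e (some b), by simp⟩, 0,
      ⟨e none, by simp⟩, hb⟩
    rw [hsum]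
    simpa using! congrFun h a

theorem exists_equiv_option_of_injective {n : ℕ} (hn : Fintype.card ι = n + 1) {c : Fin n → ι}
    (hc : Function.Injective c) : ∃ e : Option (Fin n) ≃ ι, ∀ b, e (some b) = c b := by
  obtain ⟨q, hq⟩ : ∃ q, ∀ b, c b ≠ q := by
    by_contra! h
    have hle := Fintype.card_le_of_surjective c h
    rw [Fintype.card_fin] at hle
    omega
  refine ⟨.ofBijective (fun o => o.elim q c)
    ((Fintype.bijective_iff_injective_and_card _).2 ⟨?_, by simp [hn]⟩), fun _ => rfl⟩
  rintro (_ | a) (_ | b) h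
  exacts [rfl, (hq b h.symm).elim, (hq a h).elim, congrArg some (hc h)]

theorem forall_minor_eq_zero_iff {M : Matrix ρ ι K} (hM : M *ᵥ 1 = 0) {n : ℕ}
    (hn : Fintype.card ι = n + 1) :
    (∀ (r : Fin n → ρ) (c : Fin n → ι), (M.submatrix r c).det = 0) ↔
      ∃ f, M *ᵥ f = 0 ∧ (Set.range f).Nontrivial := by
  constructor
  · intro h
    have e : Option (Fin n) ≃ ι := Fintype.equivOfCardEq (by simp [hn])
    exact (exists_nonconstant_mulVec_iff hM e).2
      ((forall_det_submatrix_eq_zero_iff _).1 fun r => h r _)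
  · intro h r c
    by_cases hc : Function.Injective c
    · obtain ⟨e, he⟩ := exists_equiv_option_of_injective hn hc
      obtain rfl : (fun b => e (some b)) = c := funext he
      exact (forall_det_submatrix_eq_zero_iff _).2 ((exists_nonconstant_mulVec_iff hM e).1 h) r
    · obtain ⟨a, b, hab, hne⟩ := Function.not_injective_iff.1 hc
      exact det_zero_of_column_eq hne fun _ => by simp only [submatrix_apply, hab]

end Minors

/-! ### The Alexander matrix -/

namespace Tangle

open SymmetricQuandle WeightedInvolution Matrix

variable {K : Type*} [Field K] {m n : ℕ} {D : Tangle m n} {L : LinkDiagram} {up : ℕ × ℕ → Bool}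
  {z : Kˣ} {f : ℕ × ℕ → K} {o : ℕ → ℕ → Bool} {c : ℕ → ℕ → K}

/-- The Alexander matrix of the diagram at `t = z`, whose columns are numbered by the points. -/
noncomputable def alexanderMatrix (D : Tangle m n) (up : ℕ × ℕ → Bool) (z : Kˣ) :
    Matrix {r // D.AlexanderRow up r} D.points K :=
  .of fun r p => evalAt z (r.1 p)

theorem sum_evalAt_single (hf : ∀ p ∉ D.points, f p = 0) (a : ℕ × ℕ) :
    ∑ p ∈ D.points, evalAt z (Pi.single (M := fun _ => ℤ[T;T⁻¹]) a 1 p) * f p = f a := by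
  simp +contextual [Pi.single_apply, apply_ite (evalAt z), hf, eq_comm]

theorem sum_evalAt_sub_single (hf : ∀ p ∉ D.points, f p = 0) (a b : ℕ × ℕ) :
    ∑ p ∈ D.points, evalAt z ((Pi.single a 1 - Pi.single b 1 : ℕ × ℕ → ℤ[T;T⁻¹]) p) * f p =
      f a - f b := by
  simp only [Pi.sub_apply, map_sub, sub_mul, Finset.sum_sub_distrib, sum_evalAt_single hf]

theorem sum_evalAt_foxRow (hf : ∀ p ∉ D.points, f p = 0) (a b c : ℕ × ℕ) :
    ∑ p ∈ D.points, evalAt z (foxRow a b c p) * f p = f a - z * f b - (1 - z) * f c := by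
  simp only [foxRow, Pi.sub_apply, Pi.smul_apply, smul_eq_mul, map_sub, map_mul, sub_mul, mul_assoc,
    Finset.sum_sub_distrib, ← Finset.mul_sum, sum_evalAt_single hf]
  simp [evalAt]

theorem alexanderMatrix_mulVec_eq_zero_iff :
    D.alexanderMatrix up z *ᵥ (fun p => f p) = 0 ↔
      ∀ r, D.AlexanderRow up r → ∑ p ∈ D.points, evalAt z (r p) * f p = 0 := by
  simp only [funext_iff, Subtype.forall, ← Finset.sum_coe_sort D.points]
  rfl

theorem isColoring_of_alexanderMatrix_mulVec (hup : D.IsOrientation up)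
    (hf : ∀ p ∉ D.points, f p = 0) (h : D.alexanderMatrix up z *ᵥ (fun p => f p) = 0) :
    (oriented z).IsColoring D.word (fun k j => up (k, j)) (fun k j => f (k, j)) := by
  rw [alexanderMatrix_mulVec_eq_zero_iff] at h
  have same (a b) (hab : D.Straight a b ∨ D.OverStrand a b ∨ D.Turn a b) : f b = f a :=
    (sub_eq_zero.1 ((sum_evalAt_sub_single hf a b).symm.trans (h _ (.same a b hab)))).symm
  have fox (a b c) (habc : D.AlexanderRow up (foxRow a b c)) :
      f a = z * f b + (1 - z) * f c := by
    linear_combination (sum_evalAt_foxRow hf a b c).symm.trans (h _ habc)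
  have hz := Units.inv_mul z
  intro k p hp
  obtain ⟨left, right, vertex⟩ := hup.isColoring k p hp
  refine ⟨fun j hj => Prod.ext (left j hj) (same _ _ (.inl (.left k j p hp hj))),
    fun e => Prod.ext (right e) (same _ _ (.inl (.right k e p hp))), ?_⟩
  obtain ⟨_ | _ | (_ | _), i⟩ := p
  · exact Prod.ext vertex (same _ _ (.inr (.inr (.cup k i hp))))
  · exact Prod.ext vertex (same _ _ (.inr (.inr (.cap k i hp))))
  · refine ⟨Prod.ext vertex.1 (same _ _ (.inr (.inl (.falling k i hp)))), Prod.ext vertex.2 ?_⟩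
    simp only [quandle, oriented, add_zero]
    cases hu : up (k, i + 1)
    · exact fox _ _ _ (.falling_down k i hp hu)
    · simp only [Bool.not_true, cond_false]
      linear_combination (-z⁻¹ : K) * fox _ _ _ (.falling_up k i hp hu) +
        (f (k, i + 1) - f (k + 1, i + 1)) * hz
  · refine ⟨Prod.ext vertex.1 ?_, Prod.ext vertex.2 (same _ _ (.inr (.inl (.rising k i hp))))⟩
    simp only [quandle, oriented, add_zero]
    cases hu : up (k, i)
    · simp only [cond_false]
      linear_combination (-z⁻¹ : K) * fox _ _ _ (.rising_down k i hp hu) +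
        (f (k, i) - f (k + 1, i)) * hz
    · exact fox _ _ _ (.rising_up k i hp hu)

theorem alexanderMatrix_mulVec_of_isColoring (hf : ∀ p ∉ D.points, f p = 0)
    (h : (oriented z).IsColoring D.word (fun k j => up (k, j)) (fun k j => f (k, j))) :
    D.alexanderMatrix up z *ᵥ (fun p => f p) = 0 := by
  have left {k p} (hp : D.word[k]? = some p) {j} (hj : j < p.pos) :=
    congrArg Prod.snd ((h k p hp).1 j hj)
  have right {k p} (hp : D.word[k]? = some p) (e) := congrArg Prod.snd ((h k p hp).2.1 e)
  have hz := Units.inv_mul z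
  rw [alexanderMatrix_mulVec_eq_zero_iff]
  rintro _ (⟨a, b, hab⟩ | ⟨k, i, hp, hu⟩ | ⟨k, i, hp, hu⟩ | ⟨k, i, hp, hu⟩ | ⟨k, i, hp, hu⟩)
  · rw [sum_evalAt_sub_single hf, sub_eq_zero]
    rcases hab with (⟨k, j, p, hp, hj⟩ | ⟨k, e, p, hp⟩) | (⟨k, i, hp⟩ | ⟨k, i, hp⟩) |
      (⟨k, i, hp⟩ | ⟨k, i, hp⟩)
    · exact (left hp hj).symm
    · exact (right hp e).symm
    · exact (congrArg Prod.snd (h k _ hp).2.2.2).symm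
    · exact (congrArg Prod.snd (h k _ hp).2.2.1).symm
    · exact (congrArg Prod.snd (h k _ hp).2.2).symm
    · exact (congrArg Prod.snd (h k _ hp).2.2).symm
  all_goals rw [sum_evalAt_foxRow hf]
  · have hv := congrArg Prod.snd (h k _ hp).2.2.1
    simp only [Slice.cross, quandle, oriented, add_zero, hu, cond_true] at hv
    linear_combination hv
  · have hv := congrArg Prod.snd (h k _ hp).2.2.1
    simp only [Slice.cross, quandle, oriented, add_zero, hu, cond_false] at hv
    linear_combination -z * hv + (f (k, i) - f (k, i + 1)) * hz
  · have hv := congrArg Prod.snd (h k _ hp).2.2.2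
    simp only [Slice.cross, quandle, oriented, add_zero, hu, Bool.not_true, cond_false] at hv
    linear_combination -z * hv + (f (k, i + 1) - f (k, i)) * hz
  · have hv := congrArg Prod.snd (h k _ hp).2.2.2
    simp only [Slice.cross, quandle, oriented, add_zero, hu, Bool.not_false, cond_true] at hv
    linear_combination hv

theorem IsOrientation.alexanderMatrix_mulVec (hup : D.IsOrientation up)
    (hc : (oriented z).IsColoring D.word o c) (ho : ∀ p ∈ D.points, up p = o p.1 p.2) :
    D.alexanderMatrix up z *ᵥ (fun p => c p.1.1 p.1.2) = 0 := by
  let f (p : ℕ × ℕ) := if p ∈ D.points then c p.1 p.2 else 0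
  have hf : ∀ p ∈ D.points, f p = c p.1 p.2 := fun p hp => if_pos hp
  have hcolor := hc.beside_const D.fits hup.isColoring
    (fun k hk j hj => ho (k, j) (mem_points.2 ⟨hk, hj⟩)) 0
  have hmul := alexanderMatrix_mulVec_of_isColoring (f := f) (up := up) (fun p hp => if_neg hp)
    (hcolor.congr fun k hk => by simp [f, mem_points, hk, beside])
  simpa only [hf _ (Subtype.coe_prop _)] using hmul

theorem one_zero_mem_points (hL : L.points.Nonempty) : (1, 0) ∈ L.points := by
  have hword : L.word ≠ [] := by
    obtain ⟨⟨k, j⟩, hkj⟩ := hL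
    rintro hnil
    simpa [hnil, lineWidth] using (mem_points.1 hkj).2
  exact mem_points.2 ⟨List.length_pos_of_ne_nil hword, L.fits.lineWidth_one_pos hword⟩

theorem IsKnot.isColorable_iff (hL : L.IsKnot) (hup : L.IsOrientation up)
    (h : up (1, 0) = false) :
    L.IsColorable z ↔
      ∃ f : L.points → K, L.alexanderMatrix up z *ᵥ f = 0 ∧ (Set.range f).Nontrivial := by
  constructor
  · rintro ⟨o, c, hc, ho, hnontrivial⟩
    refine ⟨_, hup.alexanderMatrix_mulVec hc fun p hp => hL.orientation_unique hup.isColoring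
      hc.directions (one_zero_mem_points hL.1) (h.trans ho.symm) hp, ?_⟩
    rwa [labels, Set.image_eq_range] at hnontrivial
  · rintro ⟨f, hf, hnontrivial⟩
    let g (p : ℕ × ℕ) := if hp : p ∈ L.points then f ⟨p, hp⟩ else 0
    have hg : (fun p : L.points => g p) = f := funext fun p => dif_pos p.2
    refine ⟨_, _, isColoring_of_alexanderMatrix_mulVec (f := g) hup (fun p hp => dif_neg hp)
      (hg.symm ▸ hf), h, ?_⟩
    rw [labels, Set.image_eq_range]
    exact hg.symm ▸ hnontrivial

theorem IsKnot.evalAt_eq_zero_iff_isColorable [CharZero K] (hL : L.IsKnot) {Δ : ℤ[T;T⁻¹]}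
    (hΔ : L.IsAlexanderPolynomial Δ) : evalAt z Δ = 0 ↔ L.IsColorable z := by
  obtain ⟨up, hup, hbase, hgcd⟩ := hΔ
  have hconst : L.alexanderMatrix up z *ᵥ 1 = 0 :=
    hup.alexanderMatrix_mulVec (isColoring_const (A := oriented z) hup.isColoring 1)
      fun _ _ => rfl
  have hcard : Fintype.card L.points = L.points.card - 1 + 1 := by
    rw [Fintype.card_coe, Nat.sub_add_cancel hL.1.card_pos]
  rw [evalAt_eq_zero_iff_of_isGCD z (s := {μ | L.AlexanderMinor up μ}) hgcd,
    hL.isColorable_iff hup hbase, ← forall_minor_eq_zero_iff hconst hcard]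
  constructor
  · intro h r c
    have hminor := h _ ⟨fun a => (r a).1, fun b => (c b).1, fun a => (r a).2, fun b => (c b).2, rfl⟩
    rwa [RingHom.map_det] at hminor
  · rintro h _ ⟨r, c, hr, hc, rfl⟩
    rw [RingHom.map_det]
    exact h (fun a => ⟨r a, hr a⟩) fun b => ⟨c b, hc b⟩

end Tangle

theorem theoremA1_general {K : Type*} [Field K] [CharZero K] (S T : Tangle 2 2)
    (hST : (S.sum T).numerator.IsKnot) (hT : T.numerator.IsKnot) (hS : S.numerator.IsSplit)
    (ΔT ΔST : ℤ[T;T⁻¹]) (hΔT : T.numerator.IsAlexanderPolynomial ΔT)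
    (hΔST : (S.sum T).numerator.IsAlexanderPolynomial ΔST)
    (z : Kˣ) (hz : LaurentPolynomial.eval₂ (Int.castRingHom K) z ΔT = 0) :
    LaurentPolynomial.eval₂ (Int.castRingHom K) z ΔST = 0 := by
  have ⟨u, hu, hbase, _⟩ := hΔST
  have hcolorable : T.numerator.IsColorable z := (hT.evalAt_eq_zero_iff_isColorable hΔT).1 hz
  exact (hST.evalAt_eq_zero_iff_isColorable hΔST).2
    (hcolorable.numerator_sum hST hT hS hu.isColoring hbase)

/-- If `N(S + T)` and `N(T)` are knots and `N(S)` is a split link, then every complex root of the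
Alexander polynomial of `N(T)` is a root of the Alexander polynomial of `N(S + T)`.  (Laurent
polynomials are evaluated at units, that is, at nonzero complex numbers.) -/
theorem theoremA1 (S T : Tangle 2 2)
    (hST : (S.sum T).numerator.IsKnot) (hT : T.numerator.IsKnot) (hS : S.numerator.IsSplit)
    (ΔT ΔST : ℤ[T;T⁻¹]) (hΔT : T.numerator.IsAlexanderPolynomial ΔT)
    (hΔST : (S.sum T).numerator.IsAlexanderPolynomial ΔST)
    (z : ℂˣ) (hz : LaurentPolynomial.eval₂ (Int.castRingHom ℂ) z ΔT = 0) :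
    LaurentPolynomial.eval₂ (Int.castRingHom ℂ) z ΔST = 0 :=
  theoremA1_general S T hST hT hS ΔT ΔST hΔT hΔST z hz
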